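/- Let $r\ge 1$, $n\ge 0$, $d\ge 0$ be integers, $\mathfrak g=sl_{r+1}(\mathbb C)$ with its standard Chevalley generators $h_i=E_{ii}-E_{i+1,i+1}$ ($1\le i\le r$) and $\mathfrak n_+$ the strictly upper triangular matrices, and let $A=\mathbb C[x^1,\dots,x^d]$ be the algebra of functions on $\mathbb C^d$. A $\mathfrak g\otimes A$-module is called integrable if it is the direct sum of finitely many weight spaces, with integral weights, for the action of $\mathfrak h\otimes 1$. Let $W_{\mathbb C^d}(\{0\}_{n\omega_1})$ be the local Weyl module, that is, the maximal integrable $\mathfrak g\otimes A$-module generated by a vector $v$ such that for all $P\in A$ $$(\mathfrak n_+\otimes P)\,v=0,\qquad (h_1\otimes P)\,v=n\,P(0)\,v,\qquad (h_i\otimes P)\,v=0\quad (2\le i\le r),$$ where maximal means that any other such module is a quotient of it, by a map respecting the generating vectors (this module exists). Let $\mathbb C[\mathbf x_1,\dots,\mathbf x_n]$ be the algebra of polynomials in $n$ multivariables $\mathbf x_k=(x_k^1,\dots,x_k^d)$, on which the symmetric group $\Sigma_n$ acts by permuting the multivariables, and let $\mathbb C[\mathbf x_1,\dots,\mathbf x_n]_+^{\Sigma_n}$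 be the set of $\Sigma_n$-invariant polynomials that vanish at the origin. For an algebra $B$ and a subset $S\subseteq B$ write $B/\!\cdot S$ for the quotient of $B$ by the ideal generated by $S$. Let $V_{r+1}=\mathbb C^{r+1}$ be the vector representation of $sl_{r+1}$. (1) There is an isomorphism of $sl_{r+1}$-modules $$W_{\mathbb C^d}(\{0\}_{n\omega_1})\;\cong\;\Bigl(V_{r+1}^{\otimes n}\otimes \bigl(\mathbb C[\mathbf x_1,\dots,\mathbf x_n]/\!\cdot\,\mathbb C[\mathbf x_1,\dots,\mathbf x_n]_+^{\Sigma_n}\bigr)\Bigr)^{\Sigma_n},$$ where $sl_{r+1}=sl_{r+1}\otimes 1$ acts on the left hand side by restriction and on the right hand side through the factors $V_{r+1}$, and $\Sigma_n$ permutes the factors of $V_{r+1}^{\otimes n}$ and acts on the quotient algebra. (2) For all integers $i_0,\dots,i_r\ge 0$ with $i_0+\dots+i_r=n$, the weight space of $W_{\mathbb C^d}(\{0\}_{n\omega_1})$ on which each $h_j\otimes 1$ acts by $i_{j-1}-i_j$ is isomorphic as a vector space to $$\mathbb C[\mathbf x_1,\dots,\mathbf x_n]^{\Sigma_{i_0}\times\dots\times\Sigma_{i_r}}\,/\!\cdot\;\mathbb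 C[\mathbf x_1,\dots,\mathbf x_n]_+^{\Sigma_n},$$ where $\Sigma_{i_0}\times\dots\times\Sigma_{i_r}\subseteq\Sigma_n$ is the Young subgroup that permutes consecutive blocks of lengths $i_0,\dots,i_r$. -/

import Mathlib

open scoped TensorProduct Pointwise

attribute [local instance 100] LieRing.ofAssociativeRing

noncomputable section

namespace WeylModules

/-! ### The Lie algebra `sl_{r+1}` and its current algebras -/

/-- The complex Lie algebra `sl_{r+1}`. -/
abbrev SL (r : ℕ) : LieSubalgebra ℂ (Matrix (Fin (r + 1)) (Fin (r + 1)) ℂ) :=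
  LieAlgebra.SpecialLinear.sl (Fin (r + 1)) ℂ

/-- The Chevalley generator `h_i = E_{i,i} - E_{i+1,i+1}` of the Cartan subalgebra of diagonal
matrices. -/
def coroot (r : ℕ) (i : Fin r) : SL r :=
  LieAlgebra.SpecialLinear.singleSubSingle i.castSucc i.succ (1 : ℂ)

/-- The nilpotent radical `n₊` of the Borel subalgebra: strictly upper triangular matrices. -/
def nilpotentRadical (r : ℕ) : Submodule ℂ (SL r) where
  carrier := {x | ∀ i j : Fin (r + 1), j ≤ i → x.val i j = 0}
  zero_mem' := fun _ _ _ => rfl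
  add_mem' := fun {x y} hx hy i j h => by
    simp [hx i j h, hy i j h]
  smul_mem' := fun c x hx i j h => by
    simp [hx i j h]

/-- The current Lie algebra `sl_{r+1} ⊗ A`, with bracket `[x ⊗ P, y ⊗ Q] = [x, y] ⊗ PQ`
(the factor `A` is written on the left). -/
abbrev Current (r : ℕ) (A : Type*) [CommRing A] [Algebra ℂ A] : Type _ :=
  A ⊗[ℂ] (SL r)

section Modules

variable {r : ℕ} {A : Type*} [CommRing A] [Algebra ℂ A]

/-- The element `x ⊗ P` of the current algebra. -/
def cur (P : A) (x : SL r) : Current r A := P ⊗ₜ[ℂ] x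

/-- The weight space, with respect to `h ⊗ 1`, of a module over the current algebra. The weight
`μ` is given by its (integral) coordinates `μ(h_i)`. -/
def weightSpace (r : ℕ) (A : Type*) [CommRing A] [Algebra ℂ A]
    (W : Type*) [AddCommGroup W] [Module ℂ W] [LieRingModule (Current r A) W]
    [LieModule ℂ (Current r A) W] (μ : Fin r → ℤ) : Submodule ℂ W where
  carrier := {w | ∀ i : Fin r, ⁅cur (1 : A) (coroot r i), w⁆ = ((μ i : ℤ) : ℂ) • w}
  zero_mem' := fun i => by simp
  add_mem' := fun {x y} hx hy i => by rw [lie_add, hx i, hy i, smul_add]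
  smul_mem' := fun c x hx i => by rw [lie_smul, hx i, smul_comm]

variable (r A) in
/-- A module over the current algebra is (`g ⊗ 1`-)integrable if it is the direct sum of its weight
spaces for a finite set of weights in the weight lattice (a sum of weight spaces for distinct
weights is always direct). -/
def IsIntegrable (W : Type*) [AddCommGroup W] [Module ℂ W] [LieRingModule (Current r A) W]
    [LieModule ℂ (Current r A) W] : Prop :=
  ∃ D : Finset (Fin r → ℤ), ⨆ μ ∈ D, weightSpace r A W μ = ⊤

/-- A `lam`-multiset of points, a point of the variety being an algebra homomorphism `A → ℂ`. -/
abbrev PointMultiset (r : ℕ) (A : Type*) [CommRing A] [Algebra ℂ A] (lam : Fin r → ℕ) : Type _ :=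
  (i : Fin r) → Fin (lam i) → (A →ₐ[ℂ] ℂ)

/-- `W` is an integrable module over the current algebra, generated by the vector `v`, such that
`(n₊ ⊗ P) v = 0` and `(h_i ⊗ P) v = ∑_j P(Z_j^{(i)}) v` for all `i` and all `P ∈ A`. -/
structure IsHighestWeight {lam : Fin r → ℕ} (Z : PointMultiset r A lam)
    (W : Type*) [AddCommGroup W] [Module ℂ W] [LieRingModule (Current r A) W]
    [LieModule ℂ (Current r A) W] (v : W) : Prop where
  integrable : IsIntegrable r A W
  generates : LieSubmodule.lieSpan ℂ (Current r A) {v} = ⊤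
  nilpotent : ∀ x ∈ nilpotentRadical r, ∀ P : A, ⁅cur P x, v⁆ = 0
  cartan : ∀ (i : Fin r) (P : A), ⁅cur P (coroot r i), v⁆ = (∑ j : Fin (lam i), Z i j P) • v

/-- `(W, v)` is the maximal one among the modules as in `IsHighestWeight`: any other such module
is a quotient of `W`, by a map that respects the generating vectors. -/
def IsLocalWeyl.{u, a, w} {r : ℕ} {A : Type a} [CommRing A] [Algebra ℂ A] {lam : Fin r → ℕ}
    (Z : PointMultiset r A lam)
    (W : Type w) [AddCommGroup W] [Module ℂ W] [LieRingModule (Current r A) W]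
    [LieModule ℂ (Current r A) W] (v : W) : Prop :=
  IsHighestWeight Z W v ∧
    ∀ (V : Type u) [AddCommGroup V] [Module ℂ V] [LieRingModule (Current r A) V]
      [LieModule ℂ (Current r A) V] (v' : V), IsHighestWeight Z V v' →
      ∃ f : W →ₗ⁅ℂ, Current r A⁆ V, f v = v' ∧ Function.Surjective f

/-! ### Construction of the local Weyl module -/

variable (r A) in
/-- The universal enveloping algebra of the current algebra. -/
abbrev Env : Type _ := UniversalEnvelopingAlgebra ℂ (Current r A)

/-- The cyclic module `U(sl_{r+1} ⊗ A) / I` for a left ideal `I`. -/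
def Cyclic (I : Ideal (Env r A)) : Type _ := Env r A ⧸ I

namespace Cyclic

variable (I : Ideal (Env r A))

instance : AddCommGroup (Cyclic I) := inferInstanceAs (AddCommGroup (Env r A ⧸ I))

instance : Module (Env r A) (Cyclic I) := inferInstanceAs (Module (Env r A) (Env r A ⧸ I))

instance : Module ℂ (Cyclic I) := inferInstanceAs (Module ℂ (Env r A ⧸ I))

instance : IsScalarTower ℂ (Env r A) (Cyclic I) :=
  inferInstanceAs (IsScalarTower ℂ (Env r A) (Env r A ⧸ I))

/-- `x ∈ sl_{r+1} ⊗ A` acts by left multiplication by its image in the enveloping algebra. -/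
instance : LieRingModule (Current r A) (Cyclic I) where
  bracket x w := UniversalEnvelopingAlgebra.ι ℂ x • w
  add_lie x y w := by
    change UniversalEnvelopingAlgebra.ι ℂ (x + y) • w = _
    rw [map_add, add_smul]
  lie_add x w w' := smul_add _ _ _
  leibniz_lie x y w := by
    change UniversalEnvelopingAlgebra.ι ℂ x • UniversalEnvelopingAlgebra.ι ℂ y • w =
      UniversalEnvelopingAlgebra.ι ℂ ⁅x, y⁆ • w +
        UniversalEnvelopingAlgebra.ι ℂ y • UniversalEnvelopingAlgebra.ι ℂ x • w
    rw [LieHom.map_lie, LieRing.of_associative_ring_bracket, sub_smul, mul_smul, mul_smul,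
      sub_add_cancel]

instance : LieModule ℂ (Current r A) (Cyclic I) where
  smul_lie c x w := by
    change UniversalEnvelopingAlgebra.ι ℂ (c • x) • w = c • UniversalEnvelopingAlgebra.ι ℂ x • w
    rw [map_smul, smul_assoc]
  lie_smul c x w := by
    change UniversalEnvelopingAlgebra.ι ℂ x • c • w = c • UniversalEnvelopingAlgebra.ι ℂ x • w
    exact smul_algebra_smul_comm c _ w

/-- The class of `1`. -/
def gen : Cyclic I := (Submodule.Quotient.mk (1 : Env r A) : Env r A ⧸ I)

end Cyclic

/-- The left ideal of relations of the local Weyl module: the smallest possible annihilator of the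
generator of a module as in `IsHighestWeight`. -/
def weylIdeal {lam : Fin r → ℕ} (Z : PointMultiset r A lam) : Ideal (Env r A) :=
  sInf {I | IsHighestWeight Z (Cyclic I) (Cyclic.gen I)}

/-- The local Weyl module of a multiset of points. -/
abbrev LocalWeyl {lam : Fin r → ℕ} (Z : PointMultiset r A lam) : Type _ :=
  Cyclic (weylIdeal Z)

/-- The generator of the local Weyl module. -/
abbrev weylVector {lam : Fin r → ℕ} (Z : PointMultiset r A lam) : LocalWeyl Z :=
  Cyclic.gen (weylIdeal Z)

end Modules

/-- The weight `n ω₁`. -/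
def nOmegaOne (r n : ℕ) : Fin r → ℕ := fun i => if i.val = 0 then n else 0

/-- The `n ω₁`-multiset on `ℂ^d` with all its points at the origin. -/
def zeroMultiset (r n d : ℕ) :
    PointMultiset r (MvPolynomial (Fin d) ℂ) (nOmegaOne r n) :=
  fun _ _ => MvPolynomial.aeval (0 : Fin d → ℂ)

/-! ### The Frobenius transformation -/

section Tensor

variable (n : ℕ) (V : Type*) [AddCommGroup V] [Module ℂ V]

/-- The tensor power `V^{⊗n}`. -/
abbrev TPow : Type _ := ⨂[ℂ] _ : Fin n, V

/-- The action of `Σ_n` on `V^{⊗n}` by permutation of the factors. -/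
def permTensor : Representation ℂ (Equiv.Perm (Fin n)) (TPow n V) where
  toFun σ := (PiTensorProduct.reindex ℂ (fun _ : Fin n => V) σ).toLinearMap
  map_one' := by
    ext f
    simp only [LinearMap.compMultilinearMap_apply, LinearEquiv.coe_coe,
      PiTensorProduct.reindex_tprod]
    rfl
  map_mul' σ τ := by
    ext f
    simp only [LinearMap.compMultilinearMap_apply, LinearEquiv.coe_coe, Module.End.mul_apply,
      PiTensorProduct.reindex_tprod]
    rfl

theorem permTensor_tprod (σ : Equiv.Perm (Fin n)) (f : Fin n → V) :
    permTensor n V σ (PiTensorProduct.tprod ℂ f) =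
      PiTensorProduct.tprod ℂ (fun k => f (σ.symm k)) :=
  PiTensorProduct.reindex_tprod σ f

variable {V} in
/-- The endomorphism `v_1 ⊗ ⋯ ⊗ v_n ↦ v_1 ⊗ ⋯ ⊗ x v_k ⊗ ⋯ ⊗ v_n` of `V^{⊗n}`. -/
def actAt (k : Fin n) (x : Module.End ℂ V) : Module.End ℂ (TPow n V) :=
  PiTensorProduct.map (Function.update (fun _ => LinearMap.id) k x)

theorem actAt_tprod (k : Fin n) (x : Module.End ℂ V) (f : Fin n → V) :
    actAt n k x (PiTensorProduct.tprod ℂ f) =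
      PiTensorProduct.tprod ℂ (Function.update f k (x (f k))) := by
  rw [actAt, PiTensorProduct.map_tprod]
  congr 1
  ext j
  by_cases h : j = k
  · subst h; simp
  · simp [h]

theorem actAt_mul (k : Fin n) (x y : Module.End ℂ V) :
    actAt n k (x * y) = actAt n k x * actAt n k y := by
  ext f
  simp [actAt_tprod]

theorem actAt_comm {k l : Fin n} (h : k ≠ l) (x y : Module.End ℂ V) :
    actAt n k x * actAt n l y = actAt n l y * actAt n k x := by
  ext f
  simp [actAt_tprod, h, h.symm, Function.update_comm h]

theorem actAt_add (k : Fin n) (x y : Module.End ℂ V) :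
    actAt n k (x + y) = actAt n k x + actAt n k y := by
  ext f
  simp [actAt_tprod]

theorem actAt_smul (k : Fin n) (c : ℂ) (x : Module.End ℂ V) :
    actAt n k (c • x) = c • actAt n k x := by
  ext f
  simp [actAt_tprod]

/-- The action of an endomorphism `x` of `V` on `V^{⊗n}` by
`v_1 ⊗ ⋯ ⊗ v_n ↦ ∑_k v_1 ⊗ ⋯ ⊗ x v_k ⊗ ⋯ ⊗ v_n`. -/
def derivTensor : Module.End ℂ V →ₗ⁅ℂ⁆ Module.End ℂ (TPow n V) where
  toFun x := ∑ k : Fin n, actAt n k x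
  map_add' x y := by
    simp only [actAt_add, Finset.sum_add_distrib]
  map_smul' c x := by
    simp only [actAt_smul, Finset.smul_sum, RingHom.id_apply]
  map_lie' {x y} := by
    have hsub : ∀ k, actAt n k (x * y - y * x) =
        actAt n k x * actAt n k y - actAt n k y * actAt n k x := fun k => by
      rw [eq_sub_iff_add_eq, ← actAt_mul, ← actAt_mul, ← actAt_add, sub_add_cancel]
    simp only [LieRing.of_associative_ring_bracket, hsub, Finset.sum_mul_sum]
    rw [Finset.sum_comm (f := fun k l => actAt n k y * actAt n l x), ← Finset.sum_sub_distrib]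
    refine Finset.sum_congr rfl fun k _ => ?_
    rw [← Finset.sum_sub_distrib, Finset.sum_eq_single k]
    · intro l _ hl
      rw [actAt_comm n V hl y x, sub_self]
    · simp

theorem derivTensor_tprod (x : Module.End ℂ V) (f : Fin n → V) :
    derivTensor n V x (PiTensorProduct.tprod ℂ f) =
      ∑ k, PiTensorProduct.tprod ℂ (Function.update f k (x (f k))) := by
  change (∑ k : Fin n, actAt n k x) _ = _
  simp [actAt_tprod]

theorem permTensor_derivTensor (x : Module.End ℂ V) (σ : Equiv.Perm (Fin n)) :
    permTensor n V σ ∘ₗ derivTensor n V x = derivTensor n V x ∘ₗ permTensor n V σ := by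
  ext f
  simp only [LinearMap.compMultilinearMap_apply, LinearMap.comp_apply, derivTensor_tprod,
    permTensor_tprod, map_sum]
  refine Fintype.sum_equiv σ _ _ fun k => ?_
  congr 1
  ext j
  by_cases h : j = σ k
  · subst h
    simp only [Function.update_self]
    rw [Equiv.symm_apply_apply, Function.update_self]
  · have h' : σ.symm j ≠ k := fun e => h (by simp [← e])
    simp [h, h']

end Tensor

/-- The space `V_{r+1} = ℂ^{r+1}` of the vector representation of `sl_{r+1}`. -/
def VecRep (r : ℕ) : Type := Fin (r + 1) → ℂ

instance (r : ℕ) : AddCommGroup (VecRep r) := inferInstanceAs (AddCommGroup (Fin (r + 1) → ℂ))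

instance (r : ℕ) : Module ℂ (VecRep r) := inferInstanceAs (Module ℂ (Fin (r + 1) → ℂ))

/-- The vector representation: a matrix acts on a column vector by multiplication. -/
def vecAction (r : ℕ) : SL r →ₗ⁅ℂ⁆ Module.End ℂ (VecRep r) where
  toFun x :=
    { toFun := fun u => (x.val.mulVec u : Fin (r + 1) → ℂ)
      map_add' := fun u w => Matrix.mulVec_add x.val u w
      map_smul' := fun c u => Matrix.mulVec_smul x.val c u }
  map_add' x y := LinearMap.ext fun u => Matrix.add_mulVec x.val y.val u
  map_smul' c x := LinearMap.ext fun u => Matrix.smul_mulVec c x.val u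
  map_lie' {x y} := by
    have h : ∀ u : Fin (r + 1) → ℂ, (x.val * y.val - y.val * x.val).mulVec u =
        x.val.mulVec (y.val.mulVec u) - y.val.mulVec (x.val.mulVec u) := fun u => by
      rw [Matrix.sub_mulVec, Matrix.mulVec_mulVec, Matrix.mulVec_mulVec]
    exact LinearMap.ext h

section Frobenius

variable (r : ℕ) {n : ℕ} {E : Type*} [AddCommGroup E] [Module ℂ E]
  (π : Representation ℂ (Equiv.Perm (Fin n)) E)

/-- `V_{r+1}^{⊗n} ⊗ π` as a representation of `Σ_n`. -/
def tensorRep : Representation ℂ (Equiv.Perm (Fin n)) (TPow n (VecRep r) ⊗[ℂ] E) :=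
  (permTensor n (VecRep r)).tprod π

/-- The image `(V_{r+1}^{⊗n} ⊗ π)^{Σ_n}` of a representation `π` of `Σ_n` under the Frobenius
transformation. -/
abbrev Frobenius : Submodule ℂ (TPow n (VecRep r) ⊗[ℂ] E) :=
  (tensorRep r π).invariants

/-- The action of `sl_{r+1}` on `V_{r+1}^{⊗n} ⊗ π` through the factors `V_{r+1}`. -/
def slTensor (E : Type*) [AddCommGroup E] [Module ℂ E] (n : ℕ) (x : SL r) :
    Module.End ℂ (TPow n (VecRep r) ⊗[ℂ] E) :=
  (derivTensor n (VecRep r) (vecAction r x)).rTensor E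

theorem slTensor_mem (x : SL r) (t : TPow n (VecRep r) ⊗[ℂ] E) (ht : t ∈ Frobenius r π) :
    slTensor r E n x t ∈ Frobenius r π := by
  intro σ
  have h : tensorRep r π σ ∘ₗ slTensor r E n x = slTensor r E n x ∘ₗ tensorRep r π σ := by
    change TensorProduct.map _ _ ∘ₗ TensorProduct.map _ _ =
      TensorProduct.map _ _ ∘ₗ TensorProduct.map _ _
    rw [← TensorProduct.map_comp, ← TensorProduct.map_comp, permTensor_derivTensor]
    rfl
  have h' := LinearMap.congr_fun h t
  simp only [LinearMap.comp_apply] at h'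
  rw [h', ht σ]

instance : LieRingModule (SL r) (Frobenius r π) where
  bracket x t := ⟨slTensor r E n x t.val, slTensor_mem r π x t.val t.property⟩
  add_lie x y t := by
    apply Subtype.ext
    change slTensor r E n (x + y) t.val = slTensor r E n x t.val + slTensor r E n y t.val
    simp [slTensor, LinearMap.rTensor_add]
  lie_add x t t' := Subtype.ext (map_add (slTensor r E n x) t.val t'.val)
  leibniz_lie x y t := by
    apply Subtype.ext
    change slTensor r E n x (slTensor r E n y t.val) =
      slTensor r E n ⁅x, y⁆ t.val + slTensor r E n y (slTensor r E n x t.val)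
    rw [slTensor, slTensor, slTensor, LieHom.map_lie, LieHom.map_lie,
      LieRing.of_associative_ring_bracket, LinearMap.rTensor_sub, LinearMap.rTensor_mul,
      LinearMap.rTensor_mul, LinearMap.sub_apply, Module.End.mul_apply, Module.End.mul_apply,
      sub_add_cancel]

theorem coe_lie_frobenius (x : SL r) (t : Frobenius r π) :
    (⁅x, t⁆ : Frobenius r π).val = slTensor r E n x t.val := rfl

instance : LieModule ℂ (SL r) (Frobenius r π) where
  smul_lie c x t := by
    apply Subtype.ext
    change slTensor r E n (c • x) t.val = c • slTensor r E n x t.val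
    simp [slTensor, LinearMap.rTensor_smul]
  lie_smul c x t := Subtype.ext (map_smul (slTensor r E n x) c t.val)

end Frobenius

/-! ### Polynomials in `n` multivariables -/

section Polynomials

variable (n d : ℕ)

/-- The algebra `ℂ[𝐱_1, …, 𝐱_n]`, `𝐱_k = (x_k^1, …, x_k^d)`; the variable `x_k^a` is `X (k, a)`. -/
abbrev MultiPoly : Type := MvPolynomial (Fin n × Fin d) ℂ

variable {n} in
/-- The automorphism `x_k^a ↦ x_{σ k}^a`. -/
def permPoly (σ : Equiv.Perm (Fin n)) : MultiPoly n d →ₐ[ℂ] MultiPoly n d :=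
  MvPolynomial.rename (fun p : Fin n × Fin d => (σ p.1, p.2))

/-- The action of `Σ_n` on `ℂ[𝐱_1, …, 𝐱_n]` by permutation of the multivariables. -/
def polyRep : Representation ℂ (Equiv.Perm (Fin n)) (MultiPoly n d) where
  toFun σ := (permPoly d σ).toLinearMap
  map_one' := LinearMap.ext fun p => MvPolynomial.rename_id_apply p
  map_mul' σ τ := LinearMap.ext fun p => (MvPolynomial.rename_rename
    (fun q : Fin n × Fin d => (τ q.1, q.2)) (fun q : Fin n × Fin d => (σ q.1, q.2)) p).symm

/-- The subalgebra `ℂ[𝐱_1, …, 𝐱_n]^H` of invariants of a subgroup `H ⊆ Σ_n`. -/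
def invariantPoly (H : Subgroup (Equiv.Perm (Fin n))) : Subalgebra ℂ (MultiPoly n d) where
  carrier := {p | ∀ σ ∈ H, permPoly d σ p = p}
  mul_mem' := fun hp hq σ hσ => by rw [map_mul, hp σ hσ, hq σ hσ]
  add_mem' := fun hp hq σ hσ => by rw [map_add, hp σ hσ, hq σ hσ]
  algebraMap_mem' := fun c σ _ => AlgHom.commutes (permPoly d σ) c

/-- The set `ℂ[𝐱_1, …, 𝐱_n]_+^{Σ_n}` of `Σ_n`-invariant polynomials that vanish at the origin. -/
def symmPlus : Set (MultiPoly n d) :=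
  {p | p ∈ invariantPoly n d ⊤ ∧ MvPolynomial.aeval (0 : Fin n × Fin d → ℂ) p = 0}

/-- The ideal of `ℂ[𝐱_1, …, 𝐱_n]` generated by `ℂ[𝐱_1, …, 𝐱_n]_+^{Σ_n}`. -/
def coinvIdeal : Ideal (MultiPoly n d) := Ideal.span (symmPlus n d)

theorem coinvIdeal_le_comap (σ : Equiv.Perm (Fin n)) :
    (coinvIdeal n d).restrictScalars ℂ ≤
      ((coinvIdeal n d).restrictScalars ℂ).comap (polyRep n d σ) := by
  intro p hp
  have h : coinvIdeal n d ≤ (coinvIdeal n d).comap (permPoly d σ) :=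
    Ideal.span_le.mpr fun q hq => by
      change permPoly d σ q ∈ coinvIdeal n d
      rw [hq.1 σ (Subgroup.mem_top σ)]
      exact Ideal.subset_span hq
  exact h hp

/-- The representation of `Σ_n` in the generalized coinvariants, the quotient of
`ℂ[𝐱_1, …, 𝐱_n]` by the ideal generated by `ℂ[𝐱_1, …, 𝐱_n]_+^{Σ_n}`. -/
def coinvRep : Representation ℂ (Equiv.Perm (Fin n))
    (MultiPoly n d ⧸ (coinvIdeal n d).restrictScalars ℂ) :=
  (polyRep n d).quotient ((coinvIdeal n d).restrictScalars ℂ) (coinvIdeal_le_comap n d)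

/-- The ideal of `ℂ[𝐱_1, …, 𝐱_n]^H` generated by `ℂ[𝐱_1, …, 𝐱_n]_+^{Σ_n}`. -/
def relCoinvIdeal (H : Subgroup (Equiv.Perm (Fin n))) : Ideal (invariantPoly n d H) :=
  Ideal.span {p | p.val ∈ symmPlus n d}

variable {n} in
/-- The Young subgroup `Σ_{i_0} × ⋯ × Σ_{i_r}` of `Σ_n`, for `i_0 + ⋯ + i_r = n`: the permutations
that preserve each of the consecutive blocks of lengths `i_0, …, i_r`. -/
def youngSubgroup {r : ℕ} (i : Fin (r + 1) → ℕ) : Subgroup (Equiv.Perm (Fin n)) :=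
  ⨅ j : Fin (r + 1), MulAction.stabilizer (Equiv.Perm (Fin n))
    {k : Fin n | ∑ l ∈ Finset.Iio j, i l ≤ k.val ∧ k.val < ∑ l ∈ Finset.Iic j, i l}

end Polynomials

/-- The weight `(i_0 - i_1, i_1 - i_2, …, i_{r-1} - i_r)`. -/
def diffWeight {r : ℕ} (i : Fin (r + 1) → ℕ) : Fin r → ℤ :=
  fun j => (i j.castSucc : ℤ) - (i j.succ : ℤ)

end WeylModules

end

open WeylModules

universe u

/-! Write `F` for the invariants of `V^{⊗n}` tensored with the coinvariants. The whole current
algebra acts on `F`, with `P ⊗ x` acting by `∑_k P(𝐱_k) x^{(k)}`. The claim is that `F`, with the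
vector `e_0^{⊗n} ⊗ 1`, is itself the maximal highest weight module. Both isomorphisms follow: the
first by restricting to `sl ⊗ 1`, the second by reading off weight spaces of `F`.

`F` is a highest weight module (`isHighestWeight_frobenius`). Its weights are those of `V^{⊗n}`, and
on coinvariants the power sum `∑_k P(𝐱_k)` acts by its value `n P(0)` at the origin, which gives the
Cartan relations. Cyclicity comes from a general principle on symmetric functions,
`mem_of_symmetric_of_stable`.

Conversely, `F` maps onto every highest weight module `(V, v)` (`IsHighestWeight.exists_hom`).
Extend the action to `gl ⊗ A` by letting `P ⊗ 1` act by `n P(0)`. Put `W = A ⊗ ℂ^{r+1}` and `e = 1 ⊗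
e_0`. Integrability and `sl_2`-theory show that every element of `gl ⊗ A` that kills `e` kills `v`
(`glRep_eq_zero_of_glAct_eq_zero`). This suffices to build maps `Φ_k : W^{⊗k} → V` by the recursion
of `inducedMap`. The model is `V = Sym^n W`, `v = e^n`, where `Φ_k(t) = n!/(n-k)! · t e^{n-k}`. The
`Φ_k` are symmetric and satisfy `b Φ_k(t) = Φ_{k+1}(be ⊗ t) + Φ_k(bt)`. The relation `f^{n+1} v = 0`
forces `Φ_{n+1} = 0`, so `Φ_n` is equivariant, and it sends `e^{⊗n}` to `n! v`.

Finally `W^{⊗n}` is `ℂ[𝐱_1, …, 𝐱_n] ⊗ V_{r+1}^{⊗n}`. Since `P ⊗ 1` acts on `V` by `n P(0)`, power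
sums act through `Φ_n` by their value at the origin. Power sums generate all invariants
(`mem_of_mem_invariantPoly`), so `Φ_n` factors through the coinvariants. Restricted to `F` and
divided by `n!`, it is the required map.

For the weight spaces, an invariant vector of the given weight is determined by its coefficient at
the one basis tensor whose indices are constant on the consecutive blocks. That coefficient is a
Young-invariant coinvariant, and averaging identifies these with the stated quotient. -/

namespace WeylModules

open Function

noncomputable section

/-! ### Symmetric functions and derivations -/

/-- Induction on the number of entries different from `a`. Applying a derivation-like operator with
`β a = u` to a tuple creates one entry `u` out of an entry `a`; by symmetry it does not matter
which, and the other terms of the sum have no more entries different from `a` than before. This one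
argument serves three times: for the vanishing of `Φ_{n+1}`, for the generation of invariants by
power sums, and for cyclicity of the Frobenius transform. -/
theorem mem_of_symmetric_of_stable {ι W X : Type*} [Fintype ι] [DecidableEq ι]
    [AddCommGroup X] [Module ℂ X] (N : Submodule ℂ X) (f : (ι → W) → X)
    (hsymm : ∀ (w : ι → W) (σ : Equiv.Perm ι), f (w ∘ σ) = f w) (a : W)
    (h : ∀ u : W, ∃ β : W → W, β a = u ∧
      ∀ w, f w ∈ N → ∑ i, f (update w i (β (w i))) ∈ N)
    (ha : f (fun _ => a) ∈ N) (w : ι → W) : f w ∈ N := by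
  classical
  induction hk : (Finset.univ.filter fun i => w i ≠ a).card using Nat.strong_induction_on
    generalizing w with
  | _ k ih =>
  by_cases hall : ∀ i, w i = a
  · rwa [show w = fun _ => a from funext hall]
  push Not at hall
  obtain ⟨i₀, hi₀⟩ := hall
  set w' := update w i₀ a with hw'
  have hlt : (Finset.univ.filter fun i => w' i ≠ a).card < k := by
    rw [← hk]
    refine Finset.card_lt_card ⟨fun i hi => ?_, fun hsub => ?_⟩
    · simp only [Finset.mem_filter, Finset.mem_univ, true_and] at hi ⊢
      by_cases e : i = i₀
      · rwa [e]
      · simpa [hw', e] using hi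
    · have := hsub (by simpa using hi₀ : i₀ ∈ Finset.univ.filter fun i => w i ≠ a)
      simp [hw'] at this
  obtain ⟨β, hβ, hN⟩ := h (w i₀)
  have hsum := hN w' (ih _ hlt w' rfl)
  -- Putting `w i₀` at any position where `w'` has an `a` gives `w` up to the transposition of `i`
  -- and `i₀`. There is at least one such position, `i₀` itself, so `f w` occurs with a nonzero
  -- multiplicity.
  have hone : ∀ i ∈ Finset.univ.filter (fun i => w' i = a),
      f (update w' i (β (w' i))) = f w := by
    intro i hi
    simp only [Finset.mem_filter, Finset.mem_univ, true_and] at hi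
    rw [hi, hβ]
    by_cases e : i = i₀
    · subst e; simp [hw']
    · rw [← hsymm w (Equiv.swap i i₀)]
      congr 1
      have hwi : w i = a := by simpa [hw', e] using hi
      ext l
      by_cases h1 : l = i
      · subst h1; simp
      · by_cases h2 : l = i₀
        · subst h2; simp [hw', h1, hwi]
        · simp [hw', h1, h2, Equiv.swap_apply_of_ne_of_ne h1 h2]
  have htwo : ∀ i ∈ Finset.univ.filter (fun i => ¬ w' i = a),
      f (update w' i (β (w' i))) ∈ N := by
    intro i hi
    simp only [Finset.mem_filter, Finset.mem_univ, true_and] at hi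
    refine ih _ (lt_of_le_of_lt (Finset.card_le_card fun l hl => ?_) hlt) _ rfl
    simp only [Finset.mem_filter, Finset.mem_univ, true_and] at hl ⊢
    by_cases e : l = i
    · rwa [e]
    · simpa [e] using hl
  rw [← Finset.sum_filter_add_sum_filter_not Finset.univ (fun i => w' i = a),
    Submodule.add_mem_iff_left _ (N.sum_mem htwo), Finset.sum_congr rfl hone, Finset.sum_const,
    ← Nat.cast_smul_eq_nsmul ℂ] at hsum
  refine (N.smul_mem_iff ?_).1 hsum
  rw [Nat.cast_ne_zero, ← Nat.pos_iff_ne_zero, Finset.card_pos]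
  exact ⟨i₀, by simp [hw']⟩

/-! ### Primitive vectors with finitely many weights -/

/-- The `sl_2` computation `e f^{k+1} w = (k+1)(c-k) f^k w`. Some high power of `f` kills `w`
because only finitely many eigenvalues of `h` occur; the formula then lowers the exponent as long as
`c ≠ k`. With `c` not a natural number and `m = 0`, it says that `w` itself vanishes. -/
theorem pow_apply_eq_zero_of_primitive {V : Type*} [AddCommGroup V] [Module ℂ V]
    {e f h : Module.End ℂ V} (hef : e * f - f * e = h) (hhf : h * f - f * h = (-2 : ℂ) • f)
    (S : Finset ℂ) (hS : ∀ c ∉ S, ∀ w, h w = c • w → w = 0)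
    {w : V} {c : ℂ} (hew : e w = 0) (hhw : h w = c • w) (m : ℕ) (hm : ∀ k : ℕ, m ≤ k → c ≠ k) :
    (f ^ m) w = 0 := by
  have hwt : ∀ k : ℕ, h ((f ^ k) w) = (c - 2 * k) • (f ^ k) w := by
    intro k
    induction k with
    | zero => simp [hhw]
    | succ k ih =>
      have := LinearMap.congr_fun hhf ((f ^ k) w)
      simp only [LinearMap.sub_apply, Module.End.mul_apply, LinearMap.smul_apply, ih,
        map_smul] at this
      rw [pow_succ', Module.End.mul_apply, sub_eq_iff_eq_add.1 this, ← add_smul]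
      congr 1; push_cast; ring
  have hef' : ∀ k : ℕ, e ((f ^ (k + 1)) w) = ((k + 1) * (c - k)) • (f ^ k) w := by
    intro k
    induction k with
    | zero =>
      have := LinearMap.congr_fun hef w
      simp only [LinearMap.sub_apply, Module.End.mul_apply, hew, map_zero, sub_zero] at this
      simp [this, hhw]
    | succ k ih =>
      have := LinearMap.congr_fun hef ((f ^ (k + 1)) w)
      simp only [LinearMap.sub_apply, Module.End.mul_apply, ih, map_smul] at this
      rw [pow_succ' f (k + 1), Module.End.mul_apply, sub_eq_iff_eq_add.1 this, hwt,
        ← Module.End.mul_apply, ← pow_succ', ← add_smul]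
      congr 1; push_cast; ring
  -- The vectors `f^k w` satisfy the eigenvalue equations for the pairwise distinct numbers `c -
  -- 2k`, and only finitely many of these lie in `S`.
  obtain ⟨K, hmK, hK⟩ : ∃ K, m ≤ K ∧ (f ^ K) w = 0 := by
    have hinj : Function.Injective fun k : ℕ => c - 2 * (k : ℂ) := fun a b hab => by
      simpa using hab
    obtain ⟨b, hb⟩ := (S.finite_toSet.preimage (f := fun k : ℕ => c - 2 * (k : ℂ))
      hinj.injOn).bddAbove
    refine ⟨max m (b + 1), le_max_left _ _, hS _ (fun hmem => ?_) _ (hwt _)⟩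
    have := hb (show max m (b + 1) ∈ _ from hmem)
    omega
  induction hj : K - m generalizing K with
  | zero => rwa [show m = K by omega]
  | succ j ih =>
    obtain ⟨K, rfl⟩ : ∃ K', K = K' + 1 := ⟨K - 1, by omega⟩
    refine ih K (by omega) ?_ (by omega)
    have := hef' K
    rw [hK, map_zero] at this
    refine (smul_eq_zero.1 this.symm).resolve_left (mul_ne_zero K.cast_add_one_ne_zero ?_)
    exact sub_ne_zero.2 (hm K (by omega))

/-! ### Linear maps out of tensor powers -/

section TensorPower

variable {W B V : Type*} [AddCommGroup W] [Module ℂ W] [Ring B] [Algebra ℂ B]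
  [AddCommGroup V] [Module ℂ V]

variable (W) in
/-- The map `u ↦ t ↦ u ⊗ t`. -/
def consTensor (k : ℕ) : W →ₗ[ℂ] TPow k W →ₗ[ℂ] TPow (k + 1) W :=
  (PiTensorProduct.lift (R := ℂ) (s := fun _ : Fin k => W)).toLinearMap ∘ₗ
    (PiTensorProduct.tprod ℂ (s := fun _ : Fin (k + 1) => W)).curryLeft

theorem consTensor_tprod (k : ℕ) (u : W) (t : Fin k → W) :
    consTensor W k u (PiTensorProduct.tprod ℂ t) =
      PiTensorProduct.tprod ℂ (Fin.cons u t : Fin (k + 1) → W) := by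
  simp [consTensor]

theorem hom_ext_consTensor {k : ℕ} {X : Type*} [AddCommGroup X] [Module ℂ X]
    {f g : TPow (k + 1) W →ₗ[ℂ] X}
    (h : ∀ u t, f (consTensor W k u t) = g (consTensor W k u t)) : f = g := by
  ext w
  have := h (w 0) (PiTensorProduct.tprod ℂ (Fin.tail w))
  rwa [consTensor_tprod, Fin.cons_self_tail] at this

theorem derivTensor_consTensor (k : ℕ) (x : Module.End ℂ W) (u : W) (t : TPow k W) :
    derivTensor (k + 1) W x (consTensor W k u t) =
      consTensor W k (x u) t + consTensor W k u (derivTensor k W x t) := by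
  revert t
  refine LinearMap.congr_fun (f := derivTensor (k + 1) W x ∘ₗ consTensor W k u)
    (g := consTensor W k (x u) + consTensor W k u ∘ₗ derivTensor k W x) ?_
  ext t
  simp only [LinearMap.compMultilinearMap_apply, LinearMap.comp_apply, LinearMap.add_apply,
    consTensor_tprod, derivTensor_tprod, map_sum, Fin.sum_univ_succ, Fin.cons_zero, Fin.cons_succ,
    Fin.update_cons_zero, Fin.cons_update]

theorem permTensor_consTensor (k : ℕ) (i j : Fin k) (u : W) (t : TPow k W) :
    permTensor (k + 1) W (Equiv.swap i.succ j.succ) (consTensor W k u t) =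
      consTensor W k u (permTensor k W (Equiv.swap i j) t) := by
  revert t
  refine LinearMap.congr_fun
    (f := permTensor (k + 1) W (Equiv.swap i.succ j.succ) ∘ₗ consTensor W k u)
    (g := consTensor W k u ∘ₗ permTensor k W (Equiv.swap i j)) ?_
  ext t
  simp only [LinearMap.compMultilinearMap_apply, LinearMap.comp_apply, consTensor_tprod,
    permTensor_tprod, Equiv.symm_swap]
  congr 1
  ext l
  refine Fin.cases ?_ (fun l => ?_) l
  · rw [Equiv.swap_apply_of_ne_of_ne (Fin.succ_ne_zero i).symm (Fin.succ_ne_zero j).symm]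
    rfl
  · rw [(Fin.succ_injective k).swap_apply]
    rfl

theorem permTensor_swap_consTensor (k : ℕ) (u u' : W) (t : TPow k W) :
    permTensor (k + 2) W (Equiv.swap 0 1) (consTensor W _ u (consTensor W k u' t)) =
      consTensor W _ u' (consTensor W k u t) := by
  revert t
  refine LinearMap.congr_fun
    (f := permTensor (k + 2) W (Equiv.swap 0 1) ∘ₗ consTensor W _ u ∘ₗ consTensor W k u')
    (g := consTensor W _ u' ∘ₗ consTensor W k u) ?_
  ext t
  simp only [LinearMap.compMultilinearMap_apply, LinearMap.comp_apply, consTensor_tprod,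
    permTensor_tprod, Equiv.symm_swap]
  congr 1
  ext l
  refine Fin.cases ?_ (fun l => Fin.cases ?_ (fun l => ?_) l) l
  · rw [Equiv.swap_apply_left]; rfl
  · rw [Fin.succ_zero_eq_one, Equiv.swap_apply_right]; rfl
  · rw [← Fin.succ_zero_eq_one, Equiv.swap_apply_of_ne_of_ne (Fin.succ_ne_zero _)
      (fun h => Fin.succ_ne_zero l (Fin.succ_injective _ h))]
    rfl

variable (act : B →ₐ[ℂ] Module.End ℂ W) (D : B →ₗ[ℂ] Module.End ℂ V) (L : W →ₗ[ℂ] B) (v : V)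

/-- The maps `W^{⊗k} → V` with `1 ↦ v` and
`u ⊗ t ↦ L(u) · (image of t) - (image of L(u) · t)`. -/
def inducedMap : (k : ℕ) → TPow k W →ₗ[ℂ] V
  | 0 => PiTensorProduct.lift (MultilinearMap.constOfIsEmpty ℂ _ v)
  | k + 1 => PiTensorProduct.lift (LinearMap.uncurryLeft
      (M := fun _ : Fin (k + 1) => W)
      { toFun := fun u => (D (L u) ∘ₗ inducedMap k -
          inducedMap k ∘ₗ derivTensor k W (act (L u))).compMultilinearMap (PiTensorProduct.tprod ℂ)
        map_add' := fun u u' => by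
          ext t
          simp only [map_add, LinearMap.compMultilinearMap_apply, LinearMap.sub_apply,
            LinearMap.comp_apply, LinearMap.add_apply, add_apply]
          abel
        map_smul' := fun c u => by
          ext t
          simp only [map_smul, LinearMap.compMultilinearMap_apply, LinearMap.sub_apply,
            LinearMap.comp_apply, LinearMap.smul_apply, smul_apply,
            RingHom.id_apply, smul_sub] })

theorem inducedMap_zero (w : Fin 0 → W) :
    inducedMap act D L v 0 (PiTensorProduct.tprod ℂ w) = v := by
  simp [inducedMap]

theorem inducedMap_consTensor (k : ℕ) (u : W) (t : TPow k W) :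
    inducedMap act D L v (k + 1) (consTensor W k u t) =
      D (L u) (inducedMap act D L v k t) -
        inducedMap act D L v k (derivTensor k W (act (L u)) t) := by
  revert t
  refine LinearMap.congr_fun (f := inducedMap act D L v (k + 1) ∘ₗ consTensor W k u)
    (g := D (L u) ∘ₗ inducedMap act D L v k -
      inducedMap act D L v k ∘ₗ derivTensor k W (act (L u))) ?_
  ext t
  simp [consTensor_tprod, inducedMap]

variable {act D L v} {e : W}

/-- Equivariance under the stabilizer of `e`. The hypothesis `hv` is the case `k = 0`, and the
recursion propagates it because the stabilizer absorbs the error of moving `b` past `L u`. -/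
theorem inducedMap_equivariant_of_apply_eq_zero
    (hD : ∀ b b', D (b * b' - b' * b) = D b * D b' - D b' * D b)
    (hL : ∀ u, act (L u) e = u) (hv : ∀ b, act b e = 0 → D b v = 0) (k : ℕ) :
    ∀ (b : B), act b e = 0 → ∀ t : TPow k W, D b (inducedMap act D L v k t) =
      inducedMap act D L v k (derivTensor k W (act b) t) := by
  induction k with
  | zero =>
    intro b hb
    refine LinearMap.congr_fun (f := D b ∘ₗ inducedMap act D L v 0)
      (g := inducedMap act D L v 0 ∘ₗ derivTensor 0 W (act b)) ?_
    ext t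
    simp [inducedMap_zero, derivTensor_tprod, hv b hb]
  | succ k ih =>
    intro b hb
    refine LinearMap.congr_fun (f := D b ∘ₗ inducedMap act D L v (k + 1))
      (g := inducedMap act D L v (k + 1) ∘ₗ derivTensor (k + 1) W (act b)) ?_
    refine hom_ext_consTensor fun u t => ?_
    simp only [LinearMap.comp_apply, derivTensor_consTensor, map_add, inducedMap_consTensor,
      map_sub]
    -- Since `b e = 0`, the commutator `[b, L u]` sends `e` to `b u`, as does `L (b u)`. Their
    -- difference `y` therefore lies in the stabilizer and the induction hypothesis applies to it.
    set y := b * L u - L u * b - L (act b u) with hy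
    have hy0 : act y e = 0 := by
      simp [hy, hb, hL]
    have h1 := ih y hy0 t
    have h2 := LinearMap.congr_fun (hD b (L u)) (inducedMap act D L v k t)
    have h3 : derivTensor k W (act y) = derivTensor k W (act b) * derivTensor k W (act (L u)) -
        derivTensor k W (act (L u)) * derivTensor k W (act b) -
          derivTensor k W (act (L (act b u))) := by
      rw [hy, map_sub, map_sub act, map_mul, map_mul, map_sub,
        ← LieRing.of_associative_ring_bracket, LieHom.map_lie, LieRing.of_associative_ring_bracket]
    rw [h3, hy, map_sub, LinearMap.sub_apply, h2] at h1
    simp only [LinearMap.sub_apply, Module.End.mul_apply, map_sub, ih b hb] at h1 ⊢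
    rw [sub_eq_iff_eq_add] at h1
    rw [sub_eq_iff_eq_add.1 h1]
    abel

/-- Any `b` is `L (b e)` plus an element that kills `e`. The first part contributes the defining
recursion, the second commutes with the map. -/
theorem inducedMap_equivariant
    (hD : ∀ b b', D (b * b' - b' * b) = D b * D b' - D b' * D b)
    (hL : ∀ u, act (L u) e = u) (hv : ∀ b, act b e = 0 → D b v = 0) (k : ℕ)
    (b : B) (t : TPow k W) : D b (inducedMap act D L v k t) =
      inducedMap act D L v (k + 1) (consTensor W k (act b e) t) +
        inducedMap act D L v k (derivTensor k W (act b) t) := by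
  have h := inducedMap_equivariant_of_apply_eq_zero hD hL hv k (b - L (act b e))
    (by simp [hL]) t
  simp only [map_sub, LinearMap.sub_apply] at h
  rw [inducedMap_consTensor, sub_eq_iff_eq_add.1 h]
  abel

/-- Adjacent transpositions suffice. One that fixes the first factor is handled by induction, as
permutations commute with the derivation action. The exchange of the first two factors is exactly
the equivariance formula for `[L u', L u]`. -/
theorem inducedMap_permTensor
    (hD : ∀ b b', D (b * b' - b' * b) = D b * D b' - D b' * D b)
    (hL : ∀ u, act (L u) e = u) (hv : ∀ b, act b e = 0 → D b v = 0) (k : ℕ)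
    (σ : Equiv.Perm (Fin k)) (t : TPow k W) :
    inducedMap act D L v k (permTensor k W σ t) = inducedMap act D L v k t := by
  induction k with
  | zero => rw [Subsingleton.elim σ 1, map_one]; rfl
  | succ k ih =>
    have hσ : σ ∈ Submonoid.closure
        (Set.range fun i : Fin k => Equiv.swap i.castSucc i.succ) := by
      rw [Equiv.Perm.mclosure_swap_castSucc_succ]; trivial
    induction hσ using Submonoid.closure_induction generalizing t with
    | one => rw [map_one]; rfl
    | mul σ τ _ _ h1 h2 => rw [map_mul, Module.End.mul_apply, h1, h2]
    | mem σ hσ =>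
      obtain ⟨i, rfl⟩ := hσ
      revert t
      refine LinearMap.congr_fun (f := inducedMap act D L v (k + 1) ∘ₗ permTensor (k + 1) W _)
        (g := inducedMap act D L v (k + 1)) ?_
      obtain ⟨k, rfl⟩ : ∃ k', k = k' + 1 := ⟨k - 1, by have := i.2; omega⟩
      refine Fin.cases ?_ (fun i => ?_) i
      · refine hom_ext_consTensor fun u t => ?_
        revert t
        refine LinearMap.congr_fun
          (f := (inducedMap act D L v (k + 2) ∘ₗ permTensor (k + 2) W (Equiv.swap 0 1)) ∘ₗ
            consTensor W _ u)
          (g := inducedMap act D L v (k + 2) ∘ₗ consTensor W _ u) ?_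
        refine hom_ext_consTensor fun u' t => ?_
        simp only [LinearMap.comp_apply]
        rw [permTensor_swap_consTensor]
        simp only [inducedMap_consTensor, derivTensor_consTensor, map_add, map_sub]
        -- The value of this commutator at `e` is `L(u') u - L(u) u'`, which are the two correction
        -- terms that appear when the recursion is unfolded twice in the two orders.
        have h1 := inducedMap_equivariant hD hL hv k (L u' * L u - L u * L u') t
        have h3 : derivTensor k W (act (L u' * L u - L u * L u')) =
            derivTensor k W (act (L u')) * derivTensor k W (act (L u)) -
              derivTensor k W (act (L u)) * derivTensor k W (act (L u')) := by
          rw [map_sub, map_mul, map_mul, ← LieRing.of_associative_ring_bracket, LieHom.map_lie,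
            LieRing.of_associative_ring_bracket]
        rw [h3, hD, map_sub act, map_mul, map_mul] at h1
        simp only [LinearMap.sub_apply, Module.End.mul_apply, map_sub, hL,
          inducedMap_consTensor] at h1
        rw [sub_eq_iff_eq_add] at h1
        rw [h1]
        abel
      · refine hom_ext_consTensor fun u t => ?_
        simp only [LinearMap.comp_apply]
        rw [← Fin.succ_castSucc, permTensor_consTensor]
        simp only [inducedMap_consTensor, ih]
        have := LinearMap.congr_fun (permTensor_derivTensor (k + 1) W (act (L u))
          (Equiv.swap i.castSucc i.succ)) t
        simp only [LinearMap.comp_apply] at this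
        rw [← this, ih]

end TensorPower

open Matrix

/-! ### The current algebra of `gl_{r+1}` -/

/-- The space of complex square matrices of size `r + 1`. -/
abbrev Mat (r : ℕ) : Type := Matrix (Fin (r + 1)) (Fin (r + 1)) ℂ

/-- The projection of `gl_{r+1}` onto `sl_{r+1}` along the scalar matrices. -/
def traceless (r : ℕ) : Mat r →ₗ[ℂ] SL r where
  toFun x := ⟨x - (x.trace / (r + 1)) • (1 : Mat r), by
    rw [SL, LieAlgebra.SpecialLinear.sl]
    change Matrix.traceLinearMap _ ℂ ℂ _ = 0
    have h : (r : ℂ) + 1 ≠ 0 := r.cast_add_one_ne_zero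
    simp [Matrix.trace_sub, Matrix.trace_smul, Matrix.trace_one]
    field_simp
    ring⟩
  map_add' x y := by
    apply Subtype.ext
    simp only [Matrix.trace_add, add_div, add_smul]
    exact add_sub_add_comm _ _ _ _
  map_smul' c x := by
    apply Subtype.ext
    simp [Matrix.trace_smul, mul_div_assoc, smul_sub, mul_smul]

theorem coe_traceless {r : ℕ} (x : Mat r) :
    (traceless r x : Mat r) = x - (x.trace / (r + 1)) • (1 : Mat r) := rfl

theorem trace_coe_sl {r : ℕ} (x : SL r) : x.val.trace = 0 := x.2

theorem traceless_coe {r : ℕ} (x : SL r) : traceless r x.val = x := by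
  apply Subtype.ext
  rw [coe_traceless, trace_coe_sl]
  simp

/-- Scalar matrices are central and commutators have trace zero, so the projection to `sl` is a
homomorphism of Lie algebras. This is what lets the action be extended to `gl`. -/
theorem traceless_commutator {r : ℕ} (x y : Mat r) :
    traceless r (x * y - y * x) = ⁅traceless r x, traceless r y⁆ := by
  apply Subtype.ext
  rw [LieSubalgebra.coe_bracket, LieRing.of_associative_ring_bracket, coe_traceless, coe_traceless,
    coe_traceless, Matrix.trace_sub, Matrix.trace_mul_comm x y]
  simp only [sub_self, zero_div, zero_smul, sub_zero, mul_sub, sub_mul, Matrix.smul_mul,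
    Matrix.mul_smul, one_mul, mul_one]
  abel_nf
  simp [smul_smul, mul_comm]

theorem coe_coroot {r : ℕ} (i : Fin r) : (coroot r i : Mat r) =
    Matrix.single i.castSucc i.castSucc 1 - Matrix.single i.succ i.succ 1 := by
  simp [coroot]

theorem coroot_commutator {r : ℕ} (i : Fin r) :
    (Matrix.single i.castSucc i.castSucc 1 - Matrix.single i.succ i.succ 1 : Mat r) *
        Matrix.single i.succ i.castSucc 1 -
      Matrix.single i.succ i.castSucc 1 *
        (Matrix.single i.castSucc i.castSucc 1 - Matrix.single i.succ i.succ 1) =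
      (-2 : ℂ) • Matrix.single i.succ i.castSucc 1 := by
  have hne : i.castSucc ≠ i.succ := Fin.castSucc_lt_succ.ne
  rw [sub_mul, mul_sub, Matrix.single_mul_single_of_ne _ _ _ _ hne,
    Matrix.single_mul_single_same, Matrix.single_mul_single_same,
    Matrix.single_mul_single_of_ne _ _ _ _ hne, mul_one]
  module

/-- The action of all matrices on the vector representation. -/
def matAct (r : ℕ) : Mat r →ₐ[ℂ] Module.End ℂ (VecRep r) :=
  (Matrix.toLinAlgEquiv' : Mat r ≃ₐ[ℂ] _).toAlgHom

theorem matAct_apply {r : ℕ} (x : Mat r) (u : VecRep r) : matAct r x u = x.mulVec u := rfl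

/-- The standard basis vectors of the vector representation. -/
def stdVec (r : ℕ) (j : Fin (r + 1)) : VecRep r := (Pi.single j 1 : Fin (r + 1) → ℂ)

theorem matAct_single_stdVec {r : ℕ} (i j l : Fin (r + 1)) (c : ℂ) :
    matAct r (Matrix.single i j c) (stdVec r l) = if j = l then c • stdVec r i else 0 := by
  rw [matAct_apply]
  change Matrix.mulVec _ (Pi.single l 1 : Fin (r + 1) → ℂ) = _
  rw [Matrix.mulVec_single_one]
  split_ifs with h
  · subst h
    ext k
    change Matrix.single i j c k j = c * (Pi.single i 1 : Fin (r + 1) → ℂ) k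
    simp [Matrix.single_apply, Pi.single_apply, eq_comm]
  · ext k
    exact Matrix.single_apply_of_ne _ _ _ _ _ fun e => h e.2

/-- The matrix with `j`-th column `u` and all other columns zero. -/
def columnMat (r : ℕ) (j : Fin (r + 1)) : VecRep r →ₗ[ℂ] Mat r where
  toFun u := Matrix.of fun i l => if l = j then u i else 0
  map_add' u u' := by
    ext i l
    by_cases h : l = j
    · simp [h]; rfl
    · simp [h]
  map_smul' c u := by
    ext i l
    by_cases h : l = j
    · simp [h]; rfl
    · simp [h]

theorem matAct_columnMat {r : ℕ} (j l : Fin (r + 1)) (u : VecRep r) :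
    matAct r (columnMat r j u) (stdVec r l) = if l = j then u else 0 := by
  rw [matAct_apply]
  change Matrix.mulVec _ (Pi.single l 1 : Fin (r + 1) → ℂ) = _
  rw [Matrix.mulVec_single_one]
  split_ifs with h
  · ext k
    simp [columnMat, Matrix.col, h]
  · ext k
    simp [columnMat, Matrix.col, h]
    rfl

section Current

variable {r : ℕ} {A : Type*} [CommRing A] [Algebra ℂ A]

variable (r A) in
/-- The action of `A ⊗ gl_{r+1}` on `A ⊗ ℂ^{r+1}`. -/
def glAct : A ⊗[ℂ] Mat r →ₐ[ℂ] Module.End ℂ (A ⊗[ℂ] VecRep r) :=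
  (Module.endTensorEndAlgHom (R := ℂ) (S := ℂ) (A := ℂ) (M := A) (N := VecRep r)).comp
    (Algebra.TensorProduct.map (Algebra.lmul ℂ A) (matAct r))

theorem glAct_tmul (P Q : A) (x : Mat r) (u : VecRep r) :
    glAct r A (P ⊗ₜ x) (Q ⊗ₜ u) = (P * Q) ⊗ₜ matAct r x u := by
  rw [glAct, AlgHom.comp_apply, Algebra.TensorProduct.map_tmul, Module.endTensorEndAlgHom_apply]
  rfl

theorem glAct_lTensor_columnMat (j l : Fin (r + 1)) (w : A ⊗[ℂ] VecRep r) :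
    glAct r A ((columnMat r j).lTensor A w) (1 ⊗ₜ stdVec r l) = if l = j then w else 0 := by
  induction w using TensorProduct.induction_on with
  | zero => simp
  | add w w' h h' => rw [map_add, map_add, LinearMap.add_apply, h, h']; split_ifs <;> simp
  | tmul P u =>
    rw [LinearMap.lTensor_tmul, glAct_tmul, mul_one, matAct_columnMat]
    split_ifs <;> simp

variable {V : Type*} [AddCommGroup V] [Module ℂ V] [LieRingModule (Current r A) V]
  [LieModule ℂ (Current r A) V] (n : ℕ) (ε : A →ₐ[ℂ] ℂ)

variable (r V) in
/-- The extension of the action of `A ⊗ sl_{r+1}` to `A ⊗ gl_{r+1}` for which `P ⊗ 1` acts by the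
scalar `n ε(P)`. -/
def glRep : A ⊗[ℂ] Mat r →ₗ[ℂ] Module.End ℂ V :=
  (LieModule.toEnd ℂ (Current r A) V).toLinearMap ∘ₗ (traceless r).lTensor A +
    (LinearMap.mul' ℂ ℂ ∘ₗ TensorProduct.map ε.toLinearMap
      (((n : ℂ) / (r + 1)) • Matrix.traceLinearMap _ ℂ ℂ)).smulRight LinearMap.id

theorem glRep_tmul (P : A) (x : Mat r) (w : V) : glRep r V n ε (P ⊗ₜ x) w =
    ⁅cur P (traceless r x), w⁆ + (ε P * (n / (r + 1) * x.trace)) • w := by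
  simp [glRep, cur]

theorem glRep_tmul_coe (P : A) (x : SL r) (w : V) :
    glRep r V n ε (P ⊗ₜ x.val) w = ⁅cur P x, w⁆ := by
  rw [glRep_tmul, traceless_coe, trace_coe_sl]
  simp

theorem glRep_tmul_one (P : A) (w : V) :
    glRep r V n ε (P ⊗ₜ (1 : Mat r)) w = (n * ε P) • w := by
  have h : traceless r 1 = 0 := by
    apply Subtype.ext
    rw [coe_traceless]
    have h : (r : ℂ) + 1 ≠ 0 := r.cast_add_one_ne_zero
    simp [Matrix.trace_one, h]
  have h' : (r : ℂ) + 1 ≠ 0 := r.cast_add_one_ne_zero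
  rw [glRep_tmul, h, cur, TensorProduct.tmul_zero, zero_lie, zero_add, Matrix.trace_one]
  congr 1
  simp
  field_simp

theorem lie_cur_cur (P Q : A) (x y : SL r) : ⁅cur P x, cur Q y⁆ = cur (P * Q) ⁅x, y⁆ :=
  LieAlgebra.ExtendScalars.bracket_tmul _ _ _ _ _ _ _ _

theorem glRep_commutator (b b' : A ⊗[ℂ] Mat r) : glRep r V n ε (b * b' - b' * b) =
    glRep r V n ε b * glRep r V n ε b' - glRep r V n ε b' * glRep r V n ε b := by
  induction b using TensorProduct.induction_on with
  | zero => simp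
  | add b c h h' =>
    simp only [add_mul, mul_add, map_add]
    rw [add_sub_add_comm, map_add, h, h', add_sub_add_comm]
  | tmul P x =>
  induction b' using TensorProduct.induction_on with
  | zero => simp
  | add b c h h' =>
    simp only [add_mul, mul_add, map_add]
    rw [add_sub_add_comm, map_add, h, h', add_sub_add_comm]
  | tmul Q y =>
    ext w
    rw [Algebra.TensorProduct.tmul_mul_tmul, Algebra.TensorProduct.tmul_mul_tmul, mul_comm Q P,
      ← TensorProduct.tmul_sub, LinearMap.sub_apply, Module.End.mul_apply, Module.End.mul_apply]
    simp only [glRep_tmul, traceless_commutator, ← lie_cur_cur, lie_lie, lie_add, lie_smul,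
      smul_add, Matrix.trace_sub, Matrix.trace_mul_comm x y, sub_self, mul_zero, zero_smul,
      smul_smul]
    rw [mul_comm (ε P * _) (ε Q * _)]
    abel

theorem glRep_commutator_tmul (P Q : A) (x y : Mat r) (w : V) :
    glRep r V n ε (P ⊗ₜ x) (glRep r V n ε (Q ⊗ₜ y) w) =
      glRep r V n ε ((P * Q) ⊗ₜ (x * y - y * x)) w +
        glRep r V n ε (Q ⊗ₜ y) (glRep r V n ε (P ⊗ₜ x) w) := by
  have := LinearMap.congr_fun (glRep_commutator (V := V) n ε (P ⊗ₜ x) (Q ⊗ₜ y)) w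
  rw [Algebra.TensorProduct.tmul_mul_tmul, Algebra.TensorProduct.tmul_mul_tmul, mul_comm Q P,
    ← TensorProduct.tmul_sub, LinearMap.sub_apply, Module.End.mul_apply,
    Module.End.mul_apply] at this
  rw [this]; abel

/-! ### Relations in highest weight modules -/

/-- The listed eigenspaces already span. An eigenspace for any further eigenvalue is independent of
them, hence zero. -/
theorem exists_finset_eigenvalues (h : IsIntegrable r A V) (i : Fin r) :
    ∃ S : Finset ℂ, ∀ c ∉ S, ∀ w : V, ⁅(cur 1 (coroot r i) : Current r A), w⁆ = c • w → w = 0 := by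
  classical
  obtain ⟨D, hD⟩ := h
  refine ⟨D.image fun μ => ((μ i : ℤ) : ℂ), fun c hc w hw => ?_⟩
  set T := LieModule.toEnd ℂ (Current r A) V (cur 1 (coroot r i))
  have hind := Module.End.eigenspaces_iSupIndep T c
  have htop : (⨆ (c' : ℂ) (_ : c' ≠ c), T.eigenspace c') = ⊤ := by
    rw [eq_top_iff, ← hD]
    refine iSup₂_le fun μ hμ => ?_
    refine le_iSup₂_of_le ((μ i : ℤ) : ℂ) (fun e => hc (e ▸ Finset.mem_image_of_mem _ hμ)) ?_
    intro x hx
    exact Module.End.mem_eigenspace_iff.2 (hx i)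
  rw [htop, disjoint_top] at hind
  exact (Submodule.mem_bot ℂ).1 (hind ▸ Module.End.mem_eigenspace_iff.2 hw)

variable {n ε} {v : V}

theorem glRep_single_of_lt (hnil : ∀ x ∈ nilpotentRadical r, ∀ P : A, ⁅cur P x, v⁆ = 0)
    {i j : Fin (r + 1)} (hij : i < j) (P : A) :
    glRep r V n ε (P ⊗ₜ Matrix.single i j 1) v = 0 := by
  have htr : (Matrix.single i j (1 : ℂ)).trace = 0 := Matrix.trace_single_eq_of_ne _ _ _ hij.ne
  rw [glRep_tmul, htr, hnil]
  · simp
  · intro k l hkl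
    rw [coe_traceless, htr]
    simp only [zero_div, zero_smul, sub_zero]
    rw [Matrix.single_apply_of_ne]
    rintro ⟨rfl, rfl⟩
    exact absurd hij (not_lt.2 hkl)

/-- The Cartan relations fix the differences of consecutive diagonal units, and the scalar by which
`P ⊗ 1` acts fixes their sum. The choice `n ε(P)` of that scalar is the one for which all units but
the first kill `v`. -/
theorem glRep_single_diag
    (hcar : ∀ (i : Fin r) (P : A), ⁅cur P (coroot r i), v⁆ = (nOmegaOne r n i * ε P : ℂ) • v)
    (j : Fin (r + 1)) (P : A) :
    glRep r V n ε (P ⊗ₜ Matrix.single j j 1) v = if j = 0 then (n * ε P) • v else 0 := by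
  set c : Fin (r + 1) → V := fun j => glRep r V n ε (P ⊗ₜ Matrix.single j j 1) v with hc
  have hstep : ∀ i : Fin r, c i.castSucc - c i.succ = (nOmegaOne r n i * ε P : ℂ) • v := by
    intro i
    rw [← hcar, ← glRep_tmul_coe n ε, coe_coroot, TensorProduct.tmul_sub, map_sub]
    rfl
  have hsum : ∑ j, c j = (n * ε P) • v := by
    rw [← glRep_tmul_one (r := r) n ε P v, ← Matrix.sum_single_one, TensorProduct.tmul_sum,
      map_sum, LinearMap.sum_apply]
  have hall : ∀ j : Fin (r + 1), c j = c 0 - if j = 0 then 0 else (n * ε P) • v := by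
    intro j
    induction j using Fin.induction with
    | zero => simp
    | succ i ih =>
      have := hstep i
      rw [ih] at this
      rw [if_neg (Fin.succ_ne_zero i)]
      by_cases h0 : i.castSucc = 0
      · have h0' : i.val = 0 := by simpa [Fin.ext_iff] using h0
        simp only [h0, if_true, sub_zero, nOmegaOne, h0'] at this
        rw [← this]; abel
      · have h0' : i.val ≠ 0 := by simpa [Fin.ext_iff] using h0
        simp only [h0, if_false, nOmegaOne, h0', Nat.cast_zero, zero_mul, zero_smul] at this
        rw [← sub_eq_zero.1 this]
  have h0 : c 0 = (n * ε P) • v := by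
    have hr : (r : ℂ) + 1 ≠ 0 := r.cast_add_one_ne_zero
    rw [Fin.sum_univ_succ, Finset.sum_congr rfl fun j _ => hall (Fin.succ j)] at hsum
    simp only [Fin.succ_ne_zero, if_false, Finset.sum_const, Finset.card_univ, Fintype.card_fin,
      ← Nat.cast_smul_eq_nsmul ℂ] at hsum
    rw [← sub_eq_zero] at hsum ⊢
    -- Every `c j` with `j ≠ 0` equals `c 0 - n ε(P) v`, so summing over `j` leaves `(r + 1)(c 0 - n
    -- ε(P) v) = 0`.
    refine (smul_eq_zero.1 (?_ : ((r : ℂ) + 1) • (c 0 - (n * ε P) • v) = 0)).resolve_left hr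
    rw [← hsum]
    module
  change c j = _
  rw [hall, h0]
  split_ifs <;> simp

theorem glRep_lowering_pow_eq_zero (hint : IsIntegrable r A V) (i : Fin r) {w : V} {c : ℂ}
    (he : glRep r V n ε (1 ⊗ₜ Matrix.single i.castSucc i.succ 1) w = 0)
    (hh : ⁅(cur 1 (coroot r i) : Current r A), w⁆ = c • w) (m : ℕ)
    (hm : ∀ k : ℕ, m ≤ k → c ≠ k) :
    (glRep r V n ε (1 ⊗ₜ Matrix.single i.succ i.castSucc 1) ^ m) w = 0 := by
  obtain ⟨S, hS⟩ := exists_finset_eigenvalues hint i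
  refine pow_apply_eq_zero_of_primitive
    (e := glRep r V n ε (1 ⊗ₜ Matrix.single i.castSucc i.succ 1))
    (h := glRep r V n ε (1 ⊗ₜ (coroot r i).val)) (c := c)
    ?_ ?_ S (fun c hc w hw => hS c hc w (by rwa [glRep_tmul_coe] at hw)) he
    (by rwa [glRep_tmul_coe]) m hm
  · ext w
    rw [LinearMap.sub_apply, Module.End.mul_apply, Module.End.mul_apply, glRep_commutator_tmul,
      add_sub_cancel_right, coe_coroot]
    simp
  · ext w
    rw [LinearMap.sub_apply, Module.End.mul_apply, Module.End.mul_apply, glRep_commutator_tmul,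
      add_sub_cancel_right, coe_coroot, coroot_commutator, TensorProduct.tmul_smul, map_smul,
      one_mul]

/-- For a simple root other than the first, `(f_i ⊗ P) v` is killed by `e_i ⊗ 1`, because `(h_i ⊗ P)
v = 0`, and satisfies the weight equation for `-2` under `h_i`. A primitive vector of negative
weight cannot survive in an integrable module. -/
theorem glRep_single_simple_lowering (hint : IsIntegrable r A V)
    (hnil : ∀ x ∈ nilpotentRadical r, ∀ P : A, ⁅cur P x, v⁆ = 0)
    (hcar : ∀ (i : Fin r) (P : A), ⁅cur P (coroot r i), v⁆ = (nOmegaOne r n i * ε P : ℂ) • v)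
    (i : Fin r) (hi : i.castSucc ≠ 0) (P : A) :
    glRep r V n ε (P ⊗ₜ Matrix.single i.succ i.castSucc 1) v = 0 := by
  -- With `m = 0` the conclusion concerns the zeroth power of the lowering operator, that is, the
  -- vector itself.
  have key := glRep_lowering_pow_eq_zero (n := n) (ε := ε) (c := -2)
    (w := glRep r V n ε (P ⊗ₜ Matrix.single i.succ i.castSucc 1) v) hint i ?_ ?_ 0 ?_
  · simpa using key
  · rw [glRep_commutator_tmul, glRep_single_of_lt hnil Fin.castSucc_lt_succ, map_zero, add_zero,
      Matrix.single_mul_single_same, Matrix.single_mul_single_same, TensorProduct.tmul_sub,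
      map_sub, LinearMap.sub_apply]
    simp only [one_mul]
    rw [glRep_single_diag hcar, glRep_single_diag hcar, if_neg hi, if_neg (Fin.succ_ne_zero i),
      sub_zero]
  · rw [← glRep_tmul_coe n ε, glRep_commutator_tmul, coe_coroot, coroot_commutator,
      TensorProduct.tmul_sub 1, map_sub _ (_ ⊗ₜ _), LinearMap.sub_apply,
      glRep_single_diag hcar, glRep_single_diag hcar, if_neg hi, if_neg (Fin.succ_ne_zero i),
      sub_zero, map_zero, add_zero, TensorProduct.tmul_smul, map_smul, one_mul]
    rfl
  · intro k _ h
    have := congrArg Complex.re h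
    simp at this
    linarith [(Nat.cast_nonneg k : (0 : ℝ) ≤ k)]

/-- Above the diagonal this is the condition on `n₊`, on the diagonal the previous computation.
Below it, `E_{ij} = [E_{ik}, E_{kj}]` with `k = j + 1` reduces to simple lowering operators by
induction on the distance to the diagonal. -/
theorem glRep_single_eq_zero (hint : IsIntegrable r A V)
    (hnil : ∀ x ∈ nilpotentRadical r, ∀ P : A, ⁅cur P x, v⁆ = 0)
    (hcar : ∀ (i : Fin r) (P : A), ⁅cur P (coroot r i), v⁆ = (nOmegaOne r n i * ε P : ℂ) • v)
    (i j : Fin (r + 1)) (hj : j ≠ 0) (P : A) :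
    glRep r V n ε (P ⊗ₜ Matrix.single i j 1) v = 0 := by
  rcases lt_trichotomy i j with h | rfl | h
  · exact glRep_single_of_lt hnil h P
  · rw [glRep_single_diag hcar, if_neg hj]
  obtain ⟨m, hm⟩ : ∃ m, j.val + 1 + m = i.val :=
    ⟨i.val - j.val - 1, by have := Fin.lt_def.1 h; omega⟩
  clear h
  induction m generalizing j P with
  | zero =>
    have hlt : j.val < r := by have := i.2; omega
    have h1 : j = (⟨j.val, hlt⟩ : Fin r).castSucc := rfl
    have h2 : i = (⟨j.val, hlt⟩ : Fin r).succ := Fin.ext (by simp; omega)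
    rw [h2]
    exact glRep_single_simple_lowering hint hnil hcar ⟨j.val, hlt⟩ hj P
  | succ m ih =>
    have hlt : j.val < r := by have := i.2; omega
    set k : Fin (r + 1) := (⟨j.val, hlt⟩ : Fin r).succ with hk
    have hij : i ≠ j := fun e => by subst e; omega
    have h1 : ∀ Q : A, glRep r V n ε (Q ⊗ₜ Matrix.single i k 1) v = 0 := fun Q =>
      ih k (Fin.succ_ne_zero _) Q (by simp [hk]; omega)
    have h2 : glRep r V n ε (1 ⊗ₜ Matrix.single k j 1) v = 0 :=
      glRep_single_simple_lowering hint hnil hcar ⟨j.val, hlt⟩ hj 1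
    have h3 := glRep_commutator_tmul n ε P 1 (Matrix.single i k 1) (Matrix.single k j 1) v
    rw [h1, h2, map_zero, map_zero, add_zero] at h3
    rw [Matrix.single_mul_single_same, Matrix.single_mul_single_of_ne _ _ _ _ hij.symm, sub_zero,
      mul_one, mul_one] at h3
    exact h3.symm

theorem glRep_lowering_pow (hint : IsIntegrable r A V)
    (hnil : ∀ x ∈ nilpotentRadical r, ∀ P : A, ⁅cur P x, v⁆ = 0)
    (hcar : ∀ (i : Fin r) (P : A), ⁅cur P (coroot r i), v⁆ = (nOmegaOne r n i * ε P : ℂ) • v)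
    (i : Fin r) (hi : i.castSucc = 0) :
    (glRep r V n ε (1 ⊗ₜ Matrix.single i.succ i.castSucc 1) ^ (n + 1)) v = 0 := by
  refine glRep_lowering_pow_eq_zero (c := n) hint i
    (glRep_single_of_lt hnil Fin.castSucc_lt_succ 1) ?_ (n + 1) fun k hk h => ?_
  · have h0 : i.val = 0 := by simpa [Fin.ext_iff] using hi
    rw [hcar]
    simp [nOmegaOne, h0]
  · have := Nat.cast_injective (R := ℂ) h
    omega

end Current

/-! ### Equivariant maps from tensor powers to a highest weight module -/

theorem derivTensor_tprod_const {W : Type*} [AddCommGroup W] [Module ℂ W] (k : ℕ)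
    (x : Module.End ℂ W) {a : W} {c : ℂ} (h : x a = c • a) :
    derivTensor k W x (PiTensorProduct.tprod ℂ fun _ => a) =
      (k * c : ℂ) • PiTensorProduct.tprod ℂ fun _ => a := by
  rw [derivTensor_tprod]
  simp only [h, MultilinearMap.map_update_smul, update_eq_self_iff.2 rfl,
    Finset.sum_const, Finset.card_univ, Fintype.card_fin, ← Nat.cast_smul_eq_nsmul ℂ, smul_smul]

theorem tprod_const_succ {W : Type*} [AddCommGroup W] [Module ℂ W] (k : ℕ) (a : W) :
    (PiTensorProduct.tprod ℂ fun _ : Fin (k + 1) => a) =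
      consTensor W k a (PiTensorProduct.tprod ℂ fun _ => a) := by
  rw [consTensor_tprod]
  congr 1
  ext i
  refine Fin.cases rfl (fun _ => rfl) i

section HighestWeight

variable {r : ℕ} {A : Type*} [CommRing A] [Algebra ℂ A]
  {V : Type*} [AddCommGroup V] [Module ℂ V] [LieRingModule (Current r A) V]
  [LieModule ℂ (Current r A) V] {n : ℕ} {ε : A →ₐ[ℂ] ℂ} {v : V}

/-- The vector `b (1 ⊗ e_0)` records the first column of `b`, and the matrix units in all other
columns kill `v`. So `b v` depends on that column alone. This is the hypothesis on stabilizers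
needed for `inducedMap`. -/
theorem glRep_eq_zero_of_glAct_eq_zero (hint : IsIntegrable r A V)
    (hnil : ∀ x ∈ nilpotentRadical r, ∀ P : A, ⁅cur P x, v⁆ = 0)
    (hcar : ∀ (i : Fin r) (P : A), ⁅cur P (coroot r i), v⁆ = (nOmegaOne r n i * ε P : ℂ) • v)
    (b : A ⊗[ℂ] Mat r) (hb : glAct r A b (1 ⊗ₜ stdVec r 0) = 0) : glRep r V n ε b v = 0 := by
  have key : ∀ b : A ⊗[ℂ] Mat r, glRep r V n ε b v =
      glRep r V n ε ((columnMat r 0).lTensor A (glAct r A b (1 ⊗ₜ stdVec r 0))) v := by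
    intro b
    induction b using TensorProduct.induction_on with
    | zero => simp
    | add b c h h' => simp only [map_add, LinearMap.add_apply, h, h']
    | tmul P x =>
      rw [glAct_tmul, LinearMap.lTensor_tmul, mul_one, ← sub_eq_zero, ← LinearMap.sub_apply,
        ← map_sub, ← TensorProduct.tmul_sub]
      set y := x - columnMat r 0 (matAct r x (stdVec r 0)) with hy
      have hy0 : ∀ i, y i 0 = 0 := by
        intro i
        have : matAct r x (stdVec r 0) i = x i 0 := by
          rw [matAct_apply]
          exact congrFun (Matrix.mulVec_single_one x 0) i
        simp [hy, columnMat, this]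
      rw [Matrix.matrix_eq_sum_single y, TensorProduct.tmul_sum, map_sum, LinearMap.sum_apply]
      refine Finset.sum_eq_zero fun i _ => ?_
      rw [TensorProduct.tmul_sum, map_sum, LinearMap.sum_apply]
      refine Finset.sum_eq_zero fun j _ => ?_
      by_cases hj : j = 0
      · subst hj
        simp [hy0]
      · rw [← mul_one (y i j), ← smul_eq_mul, ← Matrix.smul_single, TensorProduct.tmul_smul,
          map_smul, LinearMap.smul_apply, glRep_single_eq_zero hint hnil hcar i j hj, smul_zero]
  rw [key, hb, map_zero, map_zero, LinearMap.zero_apply]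

variable (n ε v) in
/-- The maps from the tensor powers of `A ⊗ ℂ^{r+1}` to a highest weight module. -/
def weylMap (k : ℕ) : TPow k (A ⊗[ℂ] VecRep r) →ₗ[ℂ] V :=
  inducedMap (glAct r A) (glRep r V n ε) ((columnMat r 0).lTensor A) v k

theorem columnMat_stdVec (j i : Fin (r + 1)) :
    columnMat r j (stdVec r i) = Matrix.single i j 1 := by
  ext k l
  by_cases h : l = j
  · subst h
    simp [columnMat, stdVec, Matrix.single_apply, Pi.single_apply, eq_comm]
  · simp [columnMat, h, Matrix.single_apply_of_ne _ _ _ _ _ fun e : i = k ∧ j = l => h e.2.symm]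

/-- Here `L (1 ⊗ e_i) = 1 ⊗ E_{i0}` kills `1 ⊗ e_i` when `i ≠ 0`, so the correction term of the
recursion drops out. -/
theorem weylMap_tprod_lowering (i : Fin (r + 1)) (hi : i ≠ 0) (k : ℕ) :
    weylMap n ε v k (PiTensorProduct.tprod ℂ fun _ => (1 : A) ⊗ₜ stdVec r i) =
      (glRep r V n ε (1 ⊗ₜ Matrix.single i 0 1) ^ k) v := by
  induction k with
  | zero => exact inducedMap_zero _ _ _ _ _
  | succ k ih =>
    rw [tprod_const_succ, weylMap, inducedMap_consTensor]
    rw [derivTensor_tprod_const (c := 0), mul_zero, zero_smul, map_zero, sub_zero, pow_succ',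
      Module.End.mul_apply, ← ih, LinearMap.lTensor_tmul, columnMat_stdVec]
    · rfl
    · rw [glAct_lTensor_columnMat, if_neg hi, zero_smul]

/-- Now `L (1 ⊗ e_0) = 1 ⊗ E_{00}` acts by `n` on `v` and by `k` on the `k`-th tensor power of `1 ⊗
e_0`. Each step of the recursion multiplies by `n - k`. -/
theorem weylMap_tprod_stdVec_zero
    (hcar : ∀ (i : Fin r) (P : A), ⁅cur P (coroot r i), v⁆ = (nOmegaOne r n i * ε P : ℂ) • v)
    (k : ℕ) :
    weylMap n ε v k (PiTensorProduct.tprod ℂ fun _ => (1 : A) ⊗ₜ stdVec r 0) =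
      (n.descFactorial k : ℂ) • v := by
  induction k with
  | zero =>
    rw [Nat.descFactorial_zero, Nat.cast_one, one_smul]
    exact inducedMap_zero _ _ _ _ _
  | succ k ih =>
    rw [tprod_const_succ, weylMap, inducedMap_consTensor]
    rw [derivTensor_tprod_const (c := 1), mul_one, map_smul]
    · rw [← weylMap, ih, map_smul, LinearMap.lTensor_tmul, columnMat_stdVec,
        glRep_single_diag hcar, if_pos rfl, map_one, mul_one, smul_smul, smul_smul, ← sub_smul,
        Nat.descFactorial_succ]
      congr 1
      -- For `k > n` the natural number `n - k` is truncated to zero, but the factor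
      -- `n.descFactorial k` has already vanished.
      rcases le_or_gt k n with h | h
      · push_cast [h]; ring
      · simp [Nat.descFactorial_eq_zero_iff_lt.2 h]
    · rw [glAct_lTensor_columnMat, if_pos rfl, one_smul]

theorem weylMap_permTensor (hint : IsIntegrable r A V)
    (hnil : ∀ x ∈ nilpotentRadical r, ∀ P : A, ⁅cur P x, v⁆ = 0)
    (hcar : ∀ (i : Fin r) (P : A), ⁅cur P (coroot r i), v⁆ = (nOmegaOne r n i * ε P : ℂ) • v)
    (k : ℕ) (σ : Equiv.Perm (Fin k)) (t : TPow k (A ⊗[ℂ] VecRep r)) :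
    weylMap n ε v k (permTensor k _ σ t) = weylMap n ε v k t :=
  inducedMap_permTensor (glRep_commutator n ε)
    (fun u => by rw [glAct_lTensor_columnMat, if_pos rfl])
    (glRep_eq_zero_of_glAct_eq_zero hint hnil hcar) k σ t

/-- The only place where the bound on powers of the first lowering operator enters. It kills the
tensor power of `1 ⊗ e_1`, and symmetry together with equivariance under the stabilizer of `1 ⊗ e_0`
spreads the vanishing to all tensors. A vector `e_1` different from `e_0` exists because `r ≥ 1`. -/
theorem weylMap_succ_eq_zero (hint : IsIntegrable r A V)
    (hnil : ∀ x ∈ nilpotentRadical r, ∀ P : A, ⁅cur P x, v⁆ = 0)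
    (hcar : ∀ (i : Fin r) (P : A), ⁅cur P (coroot r i), v⁆ = (nOmegaOne r n i * ε P : ℂ) • v)
    (hr : 1 ≤ r) :
    weylMap n ε v (n + 1) = (0 : TPow (n + 1) (A ⊗[ℂ] VecRep r) →ₗ[ℂ] V) := by
  set i : Fin r := ⟨0, hr⟩ with hi
  have hi0 : i.castSucc = 0 := rfl
  ext w
  simp only [LinearMap.compMultilinearMap_apply, LinearMap.zero_apply]
  -- The base point is `1 ⊗ e_1` rather than `1 ⊗ e_0`. The operator with column `u` in position `1`
  -- sends `1 ⊗ e_1` to `u` and kills `1 ⊗ e_0`, so it commutes with the map.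
  refine (Submodule.mem_bot ℂ).1 (mem_of_symmetric_of_stable ⊥
    (fun w => weylMap n ε v (n + 1) (PiTensorProduct.tprod ℂ w)) (fun w σ => ?_)
    (1 ⊗ₜ stdVec r i.succ) (fun u => ⟨glAct r A ((columnMat r i.succ).lTensor A u), ?_,
      fun w hw => ?_⟩) ?_ w)
  · rw [← weylMap_permTensor hint hnil hcar _ σ, permTensor_tprod]
    simp
  · rw [glAct_lTensor_columnMat, if_pos rfl]
  · rw [Submodule.mem_bot] at hw ⊢
    rw [← map_sum, ← derivTensor_tprod, weylMap, ← inducedMap_equivariant_of_apply_eq_zero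
      (glRep_commutator n ε) (fun u => by rw [glAct_lTensor_columnMat, if_pos rfl])
      (glRep_eq_zero_of_glAct_eq_zero hint hnil hcar), ← weylMap, hw, map_zero]
    rw [glAct_lTensor_columnMat, if_neg (Fin.succ_ne_zero i).symm]
  · rw [Submodule.mem_bot, weylMap_tprod_lowering _ (Fin.succ_ne_zero i)]
    exact glRep_lowering_pow hint hnil hcar i hi0

/-- The obstruction to equivariance in degree `n` is a value of the map in degree `n + 1`, which is
zero. -/
theorem weylMap_equivariant (hint : IsIntegrable r A V)
    (hnil : ∀ x ∈ nilpotentRadical r, ∀ P : A, ⁅cur P x, v⁆ = 0)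
    (hcar : ∀ (i : Fin r) (P : A), ⁅cur P (coroot r i), v⁆ = (nOmegaOne r n i * ε P : ℂ) • v)
    (hr : 1 ≤ r) (b : A ⊗[ℂ] Mat r) (t : TPow n (A ⊗[ℂ] VecRep r)) :
    weylMap n ε v n (derivTensor n _ (glAct r A b) t) =
      glRep r V n ε b (weylMap n ε v n t) := by
  have h := inducedMap_equivariant (v := v) (glRep_commutator n ε)
    (fun u => by rw [glAct_lTensor_columnMat, if_pos rfl])
    (glRep_eq_zero_of_glAct_eq_zero hint hnil hcar) n b t
  have h0 := LinearMap.congr_fun (weylMap_succ_eq_zero hint hnil hcar hr)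
    (consTensor _ n (glAct r A b (1 ⊗ₜ stdVec r 0)) t)
  rw [weylMap] at h0
  rw [h0, LinearMap.zero_apply, zero_add] at h
  exact h.symm

end HighestWeight

/-! ### Products of polynomials in separate multivariables -/

section Polynomials

variable {n d : ℕ}

/-- The polynomial `P(𝐱_k)`. -/
def inVar (k : Fin n) : MvPolynomial (Fin d) ℂ →ₐ[ℂ] MultiPoly n d :=
  MvPolynomial.rename fun a => (k, a)

variable (n d) in
/-- The polynomial `∏ P_k(𝐱_k)`. -/
def prodPoly :
    MultilinearMap ℂ (fun _ : Fin n => MvPolynomial (Fin d) ℂ) (MultiPoly n d) :=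
  (MultilinearMap.mkPiAlgebra ℂ (Fin n) (MultiPoly n d)).compLinearMap
    fun k => (inVar k).toLinearMap

theorem prodPoly_apply (P : Fin n → MvPolynomial (Fin d) ℂ) :
    prodPoly n d P = ∏ k, inVar k (P k) := rfl

theorem prodPoly_monomial (m : Fin n × Fin d →₀ ℕ) :
    prodPoly n d (fun k => MvPolynomial.monomial (m.curry k) 1) = MvPolynomial.monomial m 1 := by
  simp only [prodPoly_apply, MvPolynomial.monomial_eq, map_one, one_mul,
    Finsupp.prod_fintype _ _ (fun _ => pow_zero _), map_prod, map_pow, inVar,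
    MvPolynomial.rename_X, Fintype.prod_prod_type]
  rfl

theorem hom_ext_prodPoly {X : Type*} [AddCommMonoid X] [Module ℂ X]
    {f g : MultiPoly n d →ₗ[ℂ] X} (h : ∀ P, f (prodPoly n d P) = g (prodPoly n d P)) : f = g := by
  refine (MvPolynomial.basisMonomials (Fin n × Fin d) ℂ).ext fun m => ?_
  simp only [MvPolynomial.coe_basisMonomials, ← prodPoly_monomial, h]

theorem inVar_mul_prodPoly (k : Fin n) (Q : MvPolynomial (Fin d) ℂ)
    (P : Fin n → MvPolynomial (Fin d) ℂ) :
    inVar k Q * prodPoly n d P = prodPoly n d (update P k (Q * P k)) := by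
  rw [prodPoly_apply, prodPoly_apply, ← Finset.mul_prod_erase _ _ (Finset.mem_univ k),
    ← Finset.mul_prod_erase Finset.univ (fun l => inVar l (update P k (Q * P k) l))
      (Finset.mem_univ k), update_self, map_mul, mul_assoc]
  congr 2
  refine Finset.prod_congr rfl fun l hl => ?_
  rw [update_of_ne (Finset.ne_of_mem_erase hl)]

theorem permPoly_inVar (σ : Equiv.Perm (Fin n)) (k : Fin n) (P : MvPolynomial (Fin d) ℂ) :
    permPoly d σ (inVar k P) = inVar (σ k) P := by
  rw [permPoly, inVar, MvPolynomial.rename_rename]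
  rfl

theorem permPoly_prodPoly (σ : Equiv.Perm (Fin n)) (P : Fin n → MvPolynomial (Fin d) ℂ) :
    permPoly d σ (prodPoly n d P) = prodPoly n d (P ∘ σ.symm) := by
  rw [prodPoly_apply, prodPoly_apply, map_prod]
  refine Fintype.prod_equiv σ _ _ fun k => ?_
  simp [permPoly_inVar]

/-- Weyl's theorem that the power sums `∑_k Q(𝐱_k)` generate the multisymmetric polynomials. The
symmetrized product `∏ P_k(𝐱_k)` is a symmetric function of the tuple `P`, and multiplying it by a
power sum replaces each `P_k` in turn by `Q P_k`. Starting from the constant tuple `1` one reaches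
all symmetrized products, and an invariant is the average of its permutations. -/
theorem mem_of_mem_invariantPoly (N : Submodule ℂ (MultiPoly n d)) (h1 : 1 ∈ N)
    (hN : ∀ (Q : MvPolynomial (Fin d) ℂ), ∀ q ∈ N, (∑ k, inVar k Q) * q ∈ N) {s : MultiPoly n d}
    (hs : s ∈ invariantPoly n d ⊤) : s ∈ N := by
  have hf : ∀ P : Fin n → MvPolynomial (Fin d) ℂ,
      ∑ σ : Equiv.Perm (Fin n), prodPoly n d (P ∘ σ) ∈ N := by
    refine mem_of_symmetric_of_stable N _ (fun P τ => ?_) 1 (fun Q => ⟨fun P => Q * P, mul_one Q,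
      fun P hP => ?_⟩) ?_
    · exact Fintype.sum_equiv (Equiv.mulLeft τ) _ _ fun σ => rfl
    · convert hN Q _ hP using 1
      rw [Finset.sum_comm, Finset.mul_sum]
      refine Finset.sum_congr rfl fun σ _ => ?_
      rw [Finset.sum_mul]
      refine (Fintype.sum_equiv σ _ _ fun k => ?_).symm
      rw [inVar_mul_prodPoly]
      congr 1
      ext1 l
      by_cases h : l = k
      · subst h; simp
      · simp [h]
    · refine N.sum_mem fun σ _ => ?_
      convert h1
      simp [prodPoly_apply]
  have hsum : ∀ q : MultiPoly n d, ∑ σ : Equiv.Perm (Fin n), permPoly d σ q ∈ N := by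
    intro q
    rw [← Submodule.Quotient.mk_eq_zero, ← Submodule.mkQ_apply]
    have : N.mkQ ∘ₗ (∑ σ : Equiv.Perm (Fin n), (permPoly d σ).toLinearMap) = 0 := by
      refine hom_ext_prodPoly fun P => ?_
      rw [LinearMap.comp_apply, Submodule.mkQ_apply, LinearMap.zero_apply,
        Submodule.Quotient.mk_eq_zero, LinearMap.sum_apply]
      convert hf P using 1
      refine Fintype.sum_equiv (Equiv.inv _) _ _ fun σ => ?_
      exact permPoly_prodPoly σ P
    simpa using LinearMap.congr_fun this q
  have := hsum s
  rw [Finset.sum_congr rfl fun σ _ => hs σ (Subgroup.mem_top σ), Finset.sum_const,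
    ← Nat.cast_smul_eq_nsmul ℂ] at this
  refine (N.smul_mem_iff (Nat.cast_ne_zero.2 ?_)).1 this
  exact Finset.card_ne_zero.2 Finset.univ_nonempty

variable (n d) in
/-- The map `(∏ P_k(𝐱_k)) ⊗ (u_1 ⊗ ⋯ ⊗ u_n) ↦ (P_1 ⊗ u_1) ⊗ ⋯ ⊗ (P_n ⊗ u_n)`. -/
def gather (U : Type*) [AddCommGroup U] [Module ℂ U] :
    MultiPoly n d →ₗ[ℂ] TPow n U →ₗ[ℂ] TPow n (MvPolynomial (Fin d) ℂ ⊗[ℂ] U) :=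
  (MvPolynomial.basisMonomials (Fin n × Fin d) ℂ).constr ℂ fun m =>
    PiTensorProduct.map fun k => TensorProduct.mk ℂ _ U (MvPolynomial.monomial (m.curry k) 1)

theorem gather_prodPoly_tprod {U : Type*} [AddCommGroup U] [Module ℂ U]
    (P : Fin n → MvPolynomial (Fin d) ℂ) (u : Fin n → U) :
    gather n d U (prodPoly n d P) (PiTensorProduct.tprod ℂ u) =
      PiTensorProduct.tprod ℂ fun k => P k ⊗ₜ u k := by
  let f : MultilinearMap ℂ (fun _ : Fin n => MvPolynomial (Fin d) ℂ)
      (TPow n (MvPolynomial (Fin d) ℂ ⊗[ℂ] U)) :=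
    (LinearMap.applyₗ (PiTensorProduct.tprod ℂ u) ∘ₗ gather n d U).compMultilinearMap
      (prodPoly n d)
  let g : MultilinearMap ℂ (fun _ : Fin n => MvPolynomial (Fin d) ℂ)
      (TPow n (MvPolynomial (Fin d) ℂ ⊗[ℂ] U)) :=
    (PiTensorProduct.tprod ℂ).compLinearMap fun k => (TensorProduct.mk ℂ _ U).flip (u k)
  refine MultilinearMap.congr_fun (f := f) (g := g) ?_ P
  refine Module.Basis.ext_multilinear (fun _ => MvPolynomial.basisMonomials (Fin d) ℂ) fun m => ?_
  -- Both sides are multilinear in `P`, so monomials suffice. A family of exponents, one for each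
  -- multivariable, is a single exponent on pairs, the form in which `gather` is defined.
  obtain ⟨m, rfl⟩ : ∃ M : Fin n × Fin d →₀ ℕ, m = fun k => M.curry k :=
    ⟨(Finsupp.equivFunOnFinite.symm m).uncurry, by ext; simp⟩
  simp only [f, g, LinearMap.compMultilinearMap_apply, LinearMap.comp_apply,
    MvPolynomial.coe_basisMonomials, prodPoly_monomial, MultilinearMap.compLinearMap_apply]
  have h := (MvPolynomial.basisMonomials (Fin n × Fin d) ℂ).constr_basis ℂ (fun m =>
    PiTensorProduct.map fun k => TensorProduct.mk ℂ (MvPolynomial (Fin d) ℂ) U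
      (MvPolynomial.monomial (m.curry k) 1)) m
  rw [MvPolynomial.coe_basisMonomials] at h
  rw [gather, h]
  simp

theorem derivTensor_gather {r : ℕ} (Q : MvPolynomial (Fin d) ℂ) (x : Mat r) (q : MultiPoly n d)
    (t : TPow n (VecRep r)) :
    derivTensor n _ (glAct r _ (Q ⊗ₜ x)) (gather n d _ q t) =
      ∑ k, gather n d _ (inVar k Q * q) (actAt n k (matAct r x) t) := by
  let f : MultiPoly n d →ₗ[ℂ] TPow n (VecRep r) →ₗ[ℂ]
      TPow n (MvPolynomial (Fin d) ℂ ⊗[ℂ] VecRep r) :=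
    (gather n d (VecRep r)).compr₂
      (derivTensor n _ (glAct r (MvPolynomial (Fin d) ℂ) (Q ⊗ₜ x)))
  let g : MultiPoly n d →ₗ[ℂ] TPow n (VecRep r) →ₗ[ℂ]
      TPow n (MvPolynomial (Fin d) ℂ ⊗[ℂ] VecRep r) :=
    ∑ k, (gather n d (VecRep r)).compl₁₂ (LinearMap.mulLeft ℂ (inVar k Q))
      (actAt n k (matAct r x))
  have h : f = g := by
    refine hom_ext_prodPoly fun P => ?_
    refine PiTensorProduct.ext (MultilinearMap.ext fun u => ?_)
    simp only [f, g, LinearMap.compr₂_apply, LinearMap.compl₁₂_apply,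
      LinearMap.compMultilinearMap_apply, LinearMap.sum_apply, LinearMap.mulLeft_apply,
      inVar_mul_prodPoly, actAt_tprod, gather_prodPoly_tprod, derivTensor_tprod]
    refine Finset.sum_congr rfl fun k _ => congrArg _ ?_
    ext1 l
    by_cases h : l = k
    · subst h; simp [glAct_tmul]
    · simp [h]
  simpa [f, g, LinearMap.sum_apply] using LinearMap.congr_fun (LinearMap.congr_fun h q) t

end Polynomials

/-! ### The current algebra action on the Frobenius transform of the coinvariants -/

section Coinvariants

variable {r n d : ℕ}

/-- The space of generalized coinvariants. -/
def Coinv (n d : ℕ) : Type := MultiPoly n d ⧸ (coinvIdeal n d).restrictScalars ℂ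

instance : AddCommGroup (Coinv n d) :=
  inferInstanceAs (AddCommGroup (MultiPoly n d ⧸ (coinvIdeal n d).restrictScalars ℂ))

instance : Module ℂ (Coinv n d) :=
  inferInstanceAs (Module ℂ (MultiPoly n d ⧸ (coinvIdeal n d).restrictScalars ℂ))

variable (n d) in
/-- The representation of the symmetric group in the coinvariants. -/
def coinvAction : Representation ℂ (Equiv.Perm (Fin n)) (Coinv n d) := coinvRep n d

variable (n d) in
/-- The quotient map onto the coinvariants. -/
def toCoinv : MultiPoly n d →ₗ[ℂ] Coinv n d :=
  Submodule.mkQ ((coinvIdeal n d).restrictScalars ℂ)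

theorem toCoinv_surjective : Surjective (toCoinv n d) :=
  Submodule.mkQ_surjective ((coinvIdeal n d).restrictScalars ℂ)

theorem toCoinv_eq_zero {p : MultiPoly n d} : toCoinv n d p = 0 ↔ p ∈ coinvIdeal n d :=
  Submodule.Quotient.mk_eq_zero ((coinvIdeal n d).restrictScalars ℂ)

theorem coinvAction_toCoinv (σ : Equiv.Perm (Fin n)) (p : MultiPoly n d) :
    coinvAction n d σ (toCoinv n d p) = toCoinv n d (permPoly d σ p) := rfl

theorem hom_ext_toCoinv {X : Type*} [AddCommMonoid X] [Module ℂ X] {f g : Coinv n d →ₗ[ℂ] X}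
    (h : ∀ p, f (toCoinv n d p) = g (toCoinv n d p)) : f = g :=
  LinearMap.ext fun x => by
    obtain ⟨p, rfl⟩ := toCoinv_surjective x
    exact h p

/-- Multiplication by a polynomial on the coinvariants. -/
def mulCoinv : MultiPoly n d →ₐ[ℂ] Module.End ℂ (Coinv n d) :=
  AlgHom.ofLinearMap
    { toFun := fun p => Submodule.mapQ ((coinvIdeal n d).restrictScalars ℂ)
        ((coinvIdeal n d).restrictScalars ℂ) (LinearMap.mulLeft ℂ p)
        fun _ hq => Ideal.mul_mem_left (coinvIdeal n d) p hq
      map_add' := fun p q => hom_ext_toCoinv fun s => congrArg (toCoinv n d) (add_mul p q s)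
      map_smul' := fun c p => hom_ext_toCoinv fun s =>
        congrArg (toCoinv n d) (smul_mul_assoc c p s) }
    (hom_ext_toCoinv fun s => congrArg (toCoinv n d) (one_mul s))
    (fun p q => hom_ext_toCoinv fun s => congrArg (toCoinv n d) (mul_assoc p q s))

theorem mulCoinv_toCoinv (p q : MultiPoly n d) :
    mulCoinv p (toCoinv n d q) = toCoinv n d (p * q) := rfl

/-- Subtracting its constant term from an invariant gives one of the generators of the ideal. -/
theorem mulCoinv_of_mem_invariantPoly {s : MultiPoly n d} (hs : s ∈ invariantPoly n d ⊤) :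
    mulCoinv s = (MvPolynomial.aeval (0 : Fin n × Fin d → ℂ) s) • LinearMap.id := by
  refine hom_ext_toCoinv fun q => ?_
  rw [mulCoinv_toCoinv, LinearMap.smul_apply, LinearMap.id_apply, ← sub_eq_zero, ← map_smul,
    ← map_sub, toCoinv_eq_zero, Algebra.smul_def, ← sub_mul]
  refine Ideal.mul_mem_right _ _ (Ideal.subset_span ⟨?_, ?_⟩)
  · exact sub_mem hs (Subalgebra.algebraMap_mem _ _)
  · simp

theorem sum_inVar_mem (P : MvPolynomial (Fin d) ℂ) :
    ∑ k, inVar k P ∈ invariantPoly n d ⊤ := by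
  intro σ _
  rw [map_sum]
  exact Fintype.sum_equiv σ _ _ fun k => permPoly_inVar σ k P

theorem aeval_inVar (k : Fin n) (P : MvPolynomial (Fin d) ℂ) :
    MvPolynomial.aeval (0 : Fin n × Fin d → ℂ) (inVar k P) =
      MvPolynomial.aeval (0 : Fin d → ℂ) P := by
  rw [inVar, MvPolynomial.aeval_rename]
  rfl

theorem mulCoinv_sum_inVar (P : MvPolynomial (Fin d) ℂ) :
    mulCoinv (n := n) (∑ k, inVar k P) =
      (n * MvPolynomial.aeval (0 : Fin d → ℂ) P : ℂ) • LinearMap.id := by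
  rw [mulCoinv_of_mem_invariantPoly (sum_inVar_mem P), map_sum,
    Finset.sum_congr rfl fun k _ => aeval_inVar k P, Finset.sum_const, Finset.card_univ,
    Fintype.card_fin, nsmul_eq_mul]

variable (r n d) in
/-- The space `V_{r+1}^{⊗n} ⊗ π` for the coinvariants `π`. -/
abbrev CoinvTensor : Type := TPow n (VecRep r) ⊗[ℂ] Coinv n d

/-- The action of `P ⊗ x` in the `k`-th multivariable. -/
def curActAt (k : Fin n) (P : MvPolynomial (Fin d) ℂ) (x : Mat r) :
    Module.End ℂ (CoinvTensor r n d) :=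
  TensorProduct.map (actAt n k (matAct r x)) (mulCoinv (inVar k P))

theorem curActAt_mul (k : Fin n) (P Q : MvPolynomial (Fin d) ℂ) (x y : Mat r) :
    curActAt (n := n) k (P * Q) (x * y) = curActAt k P x * curActAt k Q y := by
  rw [curActAt, map_mul, map_mul, map_mul, actAt_mul, TensorProduct.map_mul]
  rfl

theorem curActAt_comm {k l : Fin n} (h : k ≠ l) (P Q : MvPolynomial (Fin d) ℂ) (x y : Mat r) :
    curActAt k P x * curActAt l Q y = curActAt l Q y * curActAt k P x := by
  rw [curActAt, curActAt, ← TensorProduct.map_mul, ← TensorProduct.map_mul,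
    actAt_comm n _ h, ← map_mul, ← map_mul, mul_comm]

variable (r n d) in
/-- The action of the current algebra of `gl_{r+1}`, in which `P ⊗ x` acts by
`∑ P(𝐱_k) x^{(k)}`. -/
def curAct : MvPolynomial (Fin d) ℂ ⊗[ℂ] Mat r →ₗ[ℂ] Module.End ℂ (CoinvTensor r n d) :=
  TensorProduct.lift (LinearMap.mk₂ ℂ (fun P x => ∑ k, curActAt k P x)
    (fun P Q x => by
      simp only [curActAt, map_add, TensorProduct.map_add_right, Finset.sum_add_distrib])
    (fun c P x => by
      simp only [curActAt, map_smul, TensorProduct.map_smul_right, Finset.smul_sum])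
    (fun P x y => by
      simp only [curActAt, map_add, actAt_add, TensorProduct.map_add_left,
        Finset.sum_add_distrib])
    (fun c P x => by
      simp only [curActAt, map_smul, actAt_smul, TensorProduct.map_smul_left, Finset.smul_sum]))

theorem curAct_tmul (P : MvPolynomial (Fin d) ℂ) (x : Mat r) :
    curAct r n d (P ⊗ₜ x) = ∑ k, curActAt k P x := rfl

theorem sum_mul_sum_sub_sum_mul_sum {ι S : Type*} [Fintype ι] [Ring S] (a b : ι → S)
    (h : ∀ k l, k ≠ l → a k * b l = b l * a k) :
    (∑ k, a k) * (∑ k, b k) - (∑ k, b k) * (∑ k, a k) = ∑ k, a k * b k - ∑ k, b k * a k := by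
  rw [Finset.sum_mul_sum, Finset.sum_mul_sum, Finset.sum_comm (f := fun k l => b k * a l),
    ← Finset.sum_sub_distrib, ← Finset.sum_sub_distrib]
  refine Finset.sum_congr rfl fun k _ => ?_
  rw [← Finset.sum_sub_distrib, Finset.sum_eq_single k]
  · intro l _ hl
    rw [h k l hl.symm, sub_self]
  · simp

/-- Operators in different tensor positions commute, so only the diagonal terms of the two double
sums survive, and in a single position `P ⊗ x ↦ P(𝐱_k) x^{(k)}` is multiplicative. -/
theorem curAct_commutator (b b' : MvPolynomial (Fin d) ℂ ⊗[ℂ] Mat r) :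
    curAct r n d (b * b' - b' * b) =
      curAct r n d b * curAct r n d b' - curAct r n d b' * curAct r n d b := by
  induction b using TensorProduct.induction_on with
  | zero =>
    rw [zero_mul, mul_zero, sub_self, map_zero, zero_mul, mul_zero]
    exact (sub_self (0 : Module.End ℂ (CoinvTensor r n d))).symm
  | add b c h h' =>
    simp only [add_mul, mul_add, map_add]
    rw [add_sub_add_comm, map_add, h, h']
    abel
  | tmul P x =>
  induction b' using TensorProduct.induction_on with
  | zero =>
    rw [zero_mul, mul_zero, sub_self, map_zero, zero_mul, mul_zero]
    exact (sub_self (0 : Module.End ℂ (CoinvTensor r n d))).symm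
  | add b c h h' =>
    simp only [add_mul, mul_add, map_add]
    rw [add_sub_add_comm, map_add, h, h']
    abel
  | tmul Q y =>
    rw [Algebra.TensorProduct.tmul_mul_tmul, Algebra.TensorProduct.tmul_mul_tmul, map_sub]
    simp only [curAct_tmul, curActAt_mul]
    exact (sum_mul_sum_sub_sum_mul_sum (fun k => curActAt k P x) (fun k => curActAt k Q y)
      fun k l h => curActAt_comm h P Q x y).symm

theorem curAct_one_tmul (x : Mat r) :
    curAct r n d (1 ⊗ₜ x) = (derivTensor n (VecRep r) (matAct r x)).rTensor (Coinv n d) := by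
  simp only [curAct_tmul, curActAt, map_one]
  exact (map_sum (LinearMap.rTensorHom (Coinv n d)) (fun k => actAt n k (matAct r x)) _).symm

theorem curAct_tmul_one (P : MvPolynomial (Fin d) ℂ) :
    curAct r n d (P ⊗ₜ 1) = (n * MvPolynomial.aeval (0 : Fin d → ℂ) P : ℂ) • LinearMap.id := by
  have h1 : ∀ k : Fin n, actAt n k (1 : Module.End ℂ (VecRep r)) = LinearMap.id := fun k => by
    refine PiTensorProduct.ext (MultilinearMap.ext fun u => ?_)
    simp [actAt_tprod]
  simp only [curAct_tmul, curActAt, map_one, h1]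
  refine (map_sum (LinearMap.lTensorHom (TPow n (VecRep r)))
    (fun k : Fin n => mulCoinv (inVar k P)) Finset.univ).symm.trans ?_
  rw [← map_sum, mulCoinv_sum_inVar, map_smul, LinearMap.coe_lTensorHom, LinearMap.lTensor_id]

variable (r) in
/-- The standard basis of the vector representation. -/
def stdBasis : Module.Basis (Fin (r + 1)) ℂ (VecRep r) := Pi.basisFun ℂ (Fin (r + 1))

theorem stdBasis_apply (j : Fin (r + 1)) : stdBasis r j = stdVec r j :=
  Pi.basisFun_apply ℂ (Fin (r + 1)) j

/-- The element `(u_1 ⊗ ⋯ ⊗ u_n) ⊗ ∏ P_k(𝐱_k)`. -/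
def pureTensor (w : Fin n → MvPolynomial (Fin d) ℂ × VecRep r) : CoinvTensor r n d :=
  PiTensorProduct.tprod ℂ (fun k => (w k).2) ⊗ₜ toCoinv n d (prodPoly n d fun k => (w k).1)

theorem hom_ext_pureTensor {X : Type*} [AddCommMonoid X] [Module ℂ X]
    {f g : CoinvTensor r n d →ₗ[ℂ] X}
    (h : ∀ (P : Fin n → MvPolynomial (Fin d) ℂ) (j : Fin n → Fin (r + 1)),
      f (pureTensor fun k => (P k, stdVec r (j k))) =
        g (pureTensor fun k => (P k, stdVec r (j k)))) : f = g := by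
  refine TensorProduct.ext (PiTensorProduct.ext (Module.Basis.ext_multilinear
    (fun _ => stdBasis r)
    fun j => hom_ext_toCoinv fun q => ?_))
  revert q
  refine fun q => LinearMap.congr_fun (f := ((TensorProduct.mk ℂ _ _).compr₂ f _) ∘ₗ toCoinv n d)
    (g := ((TensorProduct.mk ℂ _ _).compr₂ g _) ∘ₗ toCoinv n d) (hom_ext_prodPoly fun P => ?_) q
  simpa [stdBasis_apply, pureTensor] using h P j

theorem curAct_pureTensor (P : MvPolynomial (Fin d) ℂ) (x : Mat r)
    (w : Fin n → MvPolynomial (Fin d) ℂ × VecRep r) :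
    curAct r n d (P ⊗ₜ x) (pureTensor w) =
      ∑ k, pureTensor (update w k (P * (w k).1, matAct r x (w k).2)) := by
  rw [curAct_tmul, LinearMap.sum_apply]
  refine Finset.sum_congr rfl fun k _ => ?_
  rw [curActAt, pureTensor, TensorProduct.map_tmul, actAt_tprod, mulCoinv_toCoinv,
    inVar_mul_prodPoly, pureTensor]
  congr 2
  · ext1 l
    by_cases h : l = k
    · subst h; simp
    · simp [h]
  · congr 1
    funext l
    by_cases h : l = k
    · subst h; simp
    · simp [h]

theorem tensorRep_pureTensor (σ : Equiv.Perm (Fin n))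
    (w : Fin n → MvPolynomial (Fin d) ℂ × VecRep r) :
    tensorRep r (coinvAction n d) σ (pureTensor w) = pureTensor (w ∘ σ.symm) := by
  change TensorProduct.map _ _ (_ ⊗ₜ _) = _
  rw [TensorProduct.map_tmul, permTensor_tprod, coinvAction_toCoinv, permPoly_prodPoly]
  rfl

theorem tensorRep_curAct (σ : Equiv.Perm (Fin n)) (b : MvPolynomial (Fin d) ℂ ⊗[ℂ] Mat r)
    (t : CoinvTensor r n d) : tensorRep r (coinvAction n d) σ (curAct r n d b t) =
      curAct r n d b (tensorRep r (coinvAction n d) σ t) := by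
  induction b using TensorProduct.induction_on with
  | zero => simp
  | add b c h h' => simp only [map_add, LinearMap.add_apply, h, h']
  | tmul P x =>
    revert t
    refine LinearMap.congr_fun (f := tensorRep r (coinvAction n d) σ ∘ₗ curAct r n d (P ⊗ₜ x))
      (g := curAct r n d (P ⊗ₜ x) ∘ₗ tensorRep r (coinvAction n d) σ) ?_
    refine hom_ext_pureTensor fun Q j => ?_
    simp only [LinearMap.comp_apply, curAct_pureTensor, map_sum, tensorRep_pureTensor]
    refine Fintype.sum_equiv σ _ _ fun k => ?_
    congr 1
    ext1 l
    by_cases h : l = σ k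
    · subst h; simp
    · have h' : σ.symm l ≠ k := fun e => h (by simp [← e])
      simp [h, h']

variable (r d) in
/-- The inclusion of the current algebra of `sl_{r+1}` into that of `gl_{r+1}`. -/
def curIncl : Current r (MvPolynomial (Fin d) ℂ) →ₗ[ℂ] MvPolynomial (Fin d) ℂ ⊗[ℂ] Mat r :=
  (SL r).toSubmodule.subtype.lTensor _

theorem curIncl_cur (P : MvPolynomial (Fin d) ℂ) (x : SL r) :
    curIncl r d (cur P x) = P ⊗ₜ x.val := rfl

theorem curIncl_lie (a b : Current r (MvPolynomial (Fin d) ℂ)) :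
    curIncl r d ⁅a, b⁆ = curIncl r d a * curIncl r d b - curIncl r d b * curIncl r d a := by
  induction a using TensorProduct.induction_on with
  | zero => simp
  | add a a' h h' => rw [add_lie, map_add, h, h', map_add]; noncomm_ring
  | tmul P x =>
  induction b using TensorProduct.induction_on with
  | zero =>
    have e : ⁅(P ⊗ₜ x : Current r (MvPolynomial (Fin d) ℂ)),
        (0 : Current r (MvPolynomial (Fin d) ℂ))⁆ = 0 :=
      lie_zero (L := Current r (MvPolynomial (Fin d) ℂ)) (M := Current r (MvPolynomial (Fin d) ℂ)) _
    rw [e]; simp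
  | add b b' h h' =>
    have e : ⁅(P ⊗ₜ x : Current r (MvPolynomial (Fin d) ℂ)), b + b'⁆ =
        ⁅(P ⊗ₜ x : Current r (MvPolynomial (Fin d) ℂ)), b⁆ +
          ⁅(P ⊗ₜ x : Current r (MvPolynomial (Fin d) ℂ)), b'⁆ :=
      lie_add (L := Current r (MvPolynomial (Fin d) ℂ)) (M := Current r (MvPolynomial (Fin d) ℂ))
        _ _ _
    rw [e, map_add, h, h', map_add]; noncomm_ring
  | tmul Q y =>
    change curIncl r d ⁅cur P x, cur Q y⁆ = curIncl r d (cur P x) * curIncl r d (cur Q y) -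
      curIncl r d (cur Q y) * curIncl r d (cur P x)
    rw [lie_cur_cur, curIncl_cur, curIncl_cur, curIncl_cur, Algebra.TensorProduct.tmul_mul_tmul,
      Algebra.TensorProduct.tmul_mul_tmul, mul_comm Q P, ← TensorProduct.tmul_sub]
    rfl

theorem curAct_mem (b : MvPolynomial (Fin d) ℂ ⊗[ℂ] Mat r)
    (t : Frobenius r (coinvAction n d)) : curAct r n d b t.val ∈ Frobenius r (coinvAction n d) :=
  fun σ => by rw [tensorRep_curAct, t.property σ]

instance : LieRingModule (Current r (MvPolynomial (Fin d) ℂ)) (Frobenius r (coinvAction n d)) where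
  bracket x t := ⟨curAct r n d (curIncl r d x) t.val, curAct_mem _ t⟩
  add_lie x y t := by
    apply Subtype.ext
    change curAct r n d (curIncl r d (x + y)) t.val = curAct r n d (curIncl r d x) t.val +
      curAct r n d (curIncl r d y) t.val
    rw [map_add, map_add, LinearMap.add_apply]
  lie_add x t t' := Subtype.ext (map_add (curAct r n d (curIncl r d x)) t.val t'.val)
  leibniz_lie x y t := by
    apply Subtype.ext
    change curAct r n d (curIncl r d x) (curAct r n d (curIncl r d y) t.val) =
      curAct r n d (curIncl r d ⁅x, y⁆) t.val +
        curAct r n d (curIncl r d y) (curAct r n d (curIncl r d x) t.val)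
    rw [curIncl_lie, curAct_commutator, LinearMap.sub_apply, Module.End.mul_apply,
      Module.End.mul_apply, sub_add_cancel]

theorem coe_lie_coinv (x : Current r (MvPolynomial (Fin d) ℂ)) (t : Frobenius r (coinvAction n d)) :
    (⁅x, t⁆ : Frobenius r (coinvAction n d)).val = curAct r n d (curIncl r d x) t.val := rfl

instance : LieModule ℂ (Current r (MvPolynomial (Fin d) ℂ)) (Frobenius r (coinvAction n d)) where
  smul_lie c x t := by
    apply Subtype.ext
    change curAct r n d (curIncl r d (c • x)) t.val = c • curAct r n d (curIncl r d x) t.val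
    rw [map_smul, map_smul, LinearMap.smul_apply]
  lie_smul c x t := Subtype.ext (map_smul (curAct r n d (curIncl r d x)) c t.val)

theorem cur_one_lie (x : SL r) (t : Frobenius r (coinvAction n d)) :
    ⁅(cur 1 x : Current r (MvPolynomial (Fin d) ℂ)), t⁆ = ⁅x, t⁆ := by
  apply Subtype.ext
  rw [coe_lie_coinv, curIncl_cur, curAct_one_tmul]
  rfl

variable (r n d) in
/-- The highest weight vector. -/
def frobeniusVector : Frobenius r (coinvAction n d) :=
  ⟨pureTensor fun _ => (1, stdVec r 0), fun σ => tensorRep_pureTensor σ _⟩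

variable (r n d) in
/-- The sum over the symmetric group. -/
def symmetrize : CoinvTensor r n d →ₗ[ℂ] Frobenius r (coinvAction n d) :=
  LinearMap.codRestrict _ (∑ σ, tensorRep r (coinvAction n d) σ) fun t τ => by
    rw [LinearMap.sum_apply, map_sum]
    refine Fintype.sum_equiv (Equiv.mulLeft τ) _ _ fun σ => ?_
    simp

theorem coe_symmetrize (t : CoinvTensor r n d) :
    (symmetrize r n d t).val = ∑ σ, tensorRep r (coinvAction n d) σ t :=
  LinearMap.sum_apply _ _ _

theorem symmetrize_coe (t : Frobenius r (coinvAction n d)) :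
    symmetrize r n d t.val = (n.factorial : ℂ) • t := by
  apply Subtype.ext
  rw [coe_symmetrize, Finset.sum_congr rfl fun σ _ => t.property σ, Finset.sum_const,
    Finset.card_univ, Fintype.card_perm, Fintype.card_fin, ← Nat.cast_smul_eq_nsmul ℂ]
  rfl

theorem symmetrize_tensorRep (σ : Equiv.Perm (Fin n)) (t : CoinvTensor r n d) :
    symmetrize r n d (tensorRep r (coinvAction n d) σ t) = symmetrize r n d t := by
  apply Subtype.ext
  rw [coe_symmetrize, coe_symmetrize]
  refine Fintype.sum_equiv (Equiv.mulRight σ) _ _ fun τ => ?_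
  simp

theorem coe_symmetrize_curAct (b : MvPolynomial (Fin d) ℂ ⊗[ℂ] Mat r) (t : CoinvTensor r n d) :
    (symmetrize r n d (curAct r n d b t)).val = curAct r n d b (symmetrize r n d t).val := by
  simp only [coe_symmetrize, map_sum, tensorRep_curAct]

/-- Symmetrization multiplies invariants by `n!`, so it is onto, and pure tensors in basis vectors
span the source. -/
theorem eq_top_of_symmetrize_mem (N : Submodule ℂ (Frobenius r (coinvAction n d)))
    (h : ∀ (P : Fin n → MvPolynomial (Fin d) ℂ) (j : Fin n → Fin (r + 1)),
      symmetrize r n d (pureTensor fun k => (P k, stdVec r (j k))) ∈ N) : N = ⊤ := by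
  set S : Submodule ℂ (CoinvTensor r n d) := N.comap (symmetrize r n d) with hS
  have h0 : S.mkQ = 0 := by
    refine hom_ext_pureTensor fun P j => ?_
    rw [LinearMap.zero_apply, Submodule.mkQ_apply]
    exact (Submodule.Quotient.mk_eq_zero S).2 (h P j)
  refine (Submodule.eq_top_iff'.2 fun t => ?_)
  have : symmetrize r n d t.val ∈ N :=
    (Submodule.Quotient.mk_eq_zero S).1 (LinearMap.congr_fun h0 t.val)
  rw [symmetrize_coe] at this
  exact (N.smul_mem_iff (Nat.cast_ne_zero.2 n.factorial_ne_zero)).1 this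

/-- The weight of the basis vector `e_{j_1} ⊗ ⋯ ⊗ e_{j_n}` of `V_{r+1}^{⊗n}`. -/
def indexWeight (j : Fin n → Fin (r + 1)) : Fin r → ℤ := fun i =>
  ∑ k, ((if j k = i.castSucc then 1 else 0) - (if j k = i.succ then 1 else 0))

theorem derivTensor_coroot (i : Fin r) (j : Fin n → Fin (r + 1)) :
    derivTensor n (VecRep r) (matAct r (coroot r i).val)
        (PiTensorProduct.tprod ℂ fun k => stdVec r (j k)) =
      ((indexWeight j i : ℤ) : ℂ) • PiTensorProduct.tprod ℂ fun k => stdVec r (j k) := by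
  rw [derivTensor_tprod, indexWeight]
  push_cast
  rw [Finset.sum_smul]
  refine Finset.sum_congr rfl fun k _ => ?_
  have h : matAct r (coroot r i).val (stdVec r (j k)) = ((if j k = i.castSucc then 1 else 0) -
      (if j k = i.succ then 1 else 0) : ℂ) • stdVec r (j k) := by
    rw [coe_coroot, map_sub, LinearMap.sub_apply, matAct_single_stdVec, matAct_single_stdVec,
      sub_smul]
    congr 1
    · by_cases h : i.castSucc = j k
      · simp [h]
      · simp [h, Ne.symm h]
    · by_cases h : i.succ = j k
      · simp [h]
      · simp [h, Ne.symm h]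
  rw [h, MultilinearMap.map_update_smul, update_eq_self_iff.2 rfl]

theorem isIntegrable_frobenius :
    IsIntegrable r (MvPolynomial (Fin d) ℂ) (Frobenius r (coinvAction n d)) := by
  classical
  refine ⟨Finset.univ.image (indexWeight (n := n) (r := r)), eq_top_of_symmetrize_mem _
    fun P j => ?_⟩
  refine Submodule.mem_iSup_of_mem (indexWeight j) (Submodule.mem_iSup_of_mem
    (Finset.mem_image_of_mem _ (Finset.mem_univ j)) fun i => ?_)
  apply Subtype.ext
  rw [coe_lie_coinv, curIncl_cur, ← coe_symmetrize_curAct, curAct_one_tmul, pureTensor,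
    LinearMap.rTensor_tmul, derivTensor_coroot, ← TensorProduct.smul_tmul', map_smul]

/-- The span is stable under all of `gl ⊗ A`, since `P ⊗ 1` acts by scalars. The matrix with first
column `u` sends `e_0` to `u`, so the principle for symmetric functions, started at the constant
tuple `(1, e_0)`, reaches every symmetrized pure tensor. -/
theorem lieSpan_frobeniusVector : LieSubmodule.lieSpan ℂ (Current r (MvPolynomial (Fin d) ℂ))
    {frobeniusVector r n d} = ⊤ := by
  set N := LieSubmodule.lieSpan ℂ (Current r (MvPolynomial (Fin d) ℂ)) {frobeniusVector r n d}
    with hN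
  have hstable : ∀ (P : MvPolynomial (Fin d) ℂ) (x : Mat r), ∀ t : CoinvTensor r n d,
      symmetrize r n d t ∈ N.toSubmodule →
      symmetrize r n d (curAct r n d (P ⊗ₜ x) t) ∈ N.toSubmodule := by
    intro P x t ht
    have h : symmetrize r n d (curAct r n d (P ⊗ₜ x) t) = ⁅cur P (traceless r x),
        symmetrize r n d t⁆ + (x.trace / (r + 1) * (n * MvPolynomial.aeval (0 : Fin d → ℂ) P)) •
          symmetrize r n d t := by
      apply Subtype.ext
      rw [coe_symmetrize_curAct, Submodule.coe_add, coe_lie_coinv, curIncl_cur, coe_traceless,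
        TensorProduct.tmul_sub, TensorProduct.tmul_smul, map_sub, map_smul, curAct_tmul_one,
        smul_smul]
      simp
    rw [h]
    exact N.toSubmodule.add_mem (N.lie_mem ht) (N.toSubmodule.smul_mem _ ht)
  have hmem : ∀ w : Fin n → MvPolynomial (Fin d) ℂ × VecRep r,
      symmetrize r n d (pureTensor w) ∈ N.toSubmodule := by
    refine mem_of_symmetric_of_stable N.toSubmodule
      (fun w => symmetrize r n d (pureTensor w)) (fun w σ => ?_) (1, stdVec r 0) (fun u =>
      ⟨fun p => (u.1 * p.1, matAct r (columnMat r 0 u.2) p.2), ?_, fun w hw => ?_⟩) ?_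
    · rw [← symmetrize_tensorRep σ, tensorRep_pureTensor]
      congr 2
      ext1 k
      simp
    · exact Prod.ext (mul_one _) ((matAct_columnMat 0 0 u.2).trans (if_pos rfl))
    · rw [← map_sum, ← curAct_pureTensor]
      exact hstable _ _ _ hw
    · have h : symmetrize r n d (pureTensor fun _ => (1, stdVec r 0)) =
        (n.factorial : ℂ) • frobeniusVector r n d := symmetrize_coe (frobeniusVector r n d)
      rw [h]
      exact N.toSubmodule.smul_mem _ (LieSubmodule.subset_lieSpan rfl)
  rw [← LieSubmodule.toSubmodule_eq_top]
  exact eq_top_of_symmetrize_mem _ fun P j => hmem _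

theorem cartan_zeroMultiset_sum (i : Fin r) (P : MvPolynomial (Fin d) ℂ) :
    ∑ j : Fin (nOmegaOne r n i), zeroMultiset r n d i j P =
      nOmegaOne r n i * MvPolynomial.aeval (0 : Fin d → ℂ) P := by
  simp [zeroMultiset]

theorem isHighestWeight_frobenius :
    IsHighestWeight (zeroMultiset r n d) (Frobenius r (coinvAction n d))
      (frobeniusVector r n d) where
  integrable := isIntegrable_frobenius
  generates := lieSpan_frobeniusVector
  nilpotent x hx P := by
    apply Subtype.ext
    rw [coe_lie_coinv, curIncl_cur]
    refine (curAct_pureTensor P x.val _).trans (Finset.sum_eq_zero fun k _ => ?_)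
    have h : matAct r x.val (stdVec r 0) = 0 := by
      funext i
      exact (congrFun (Matrix.mulVec_single_one x.val 0) i).trans (hx i 0 (Fin.zero_le i))
    rw [pureTensor, (PiTensorProduct.tprod ℂ).map_coord_zero k, TensorProduct.zero_tmul]
    simp [h]
  cartan i P := by
    apply Subtype.ext
    rw [cartan_zeroMultiset_sum, coe_lie_coinv, curIncl_cur]
    have h : matAct r (coroot r i).val (stdVec r 0) =
        (if i.val = 0 then 1 else 0 : ℂ) • stdVec r 0 := by
      rw [coe_coroot, map_sub, LinearMap.sub_apply, matAct_single_stdVec, matAct_single_stdVec,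
        if_neg (Fin.succ_ne_zero i), sub_zero]
      by_cases h : i.val = 0
      · have h' : i.castSucc = 0 := Fin.ext h
        simp [h, h']
      · have h' : i.castSucc ≠ 0 := fun e => h (by simpa [Fin.ext_iff] using e)
        simp [h, h']
    change curAct r n d _ (pureTensor _) = _ • (pureTensor _)
    rw [curAct_tmul, LinearMap.sum_apply]
    have hk : ∀ k : Fin n, curActAt k P (coroot r i).val
        (pureTensor fun _ => (1, stdVec r 0)) = (if i.val = 0 then 1 else 0 : ℂ) •
          (PiTensorProduct.tprod ℂ (fun _ => stdVec r 0) ⊗ₜ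
            mulCoinv (inVar k P) (toCoinv n d (prodPoly n d fun _ => 1))) := by
      intro k
      rw [curActAt, pureTensor, TensorProduct.map_tmul, actAt_tprod, h,
        MultilinearMap.map_update_smul, update_eq_self_iff.2 rfl, TensorProduct.smul_tmul']
    rw [Finset.sum_congr rfl fun k _ => hk k, ← Finset.smul_sum, ← TensorProduct.tmul_sum,
      ← LinearMap.sum_apply, ← map_sum, mulCoinv_sum_inVar, LinearMap.smul_apply,
      LinearMap.id_apply, TensorProduct.tmul_smul, smul_smul, pureTensor]
    congr 1
    by_cases h : i.val = 0 <;> simp [nOmegaOne, h]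

end Coinvariants

/-! ### Maps to highest weight modules -/

section MapToHighestWeight

variable {r n d : ℕ} {V : Type*} [AddCommGroup V] [Module ℂ V]
  [LieRingModule (Current r (MvPolynomial (Fin d) ℂ)) V]
  [LieModule ℂ (Current r (MvPolynomial (Fin d) ℂ)) V] {v : V}

theorem IsHighestWeight.lie_coroot (hw : IsHighestWeight (zeroMultiset r n d) V v) (i : Fin r)
    (P : MvPolynomial (Fin d) ℂ) : ⁅cur P (coroot r i), v⁆ =
      (nOmegaOne r n i * MvPolynomial.aeval (0 : Fin d → ℂ) P : ℂ) • v := by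
  rw [hw.cartan, cartan_zeroMultiset_sum]

variable (r n d v) in
/-- The map `q ↦ t ↦` image of `t ⊗ q` in a highest weight module. -/
def polyTensorMap : MultiPoly n d →ₗ[ℂ] TPow n (VecRep r) →ₗ[ℂ] V :=
  (gather n d (VecRep r)).compr₂
    (weylMap n (MvPolynomial.aeval (0 : Fin d → ℂ)) v n)

/-- Multiplication by the power sum of `Q` is the action of `Q ⊗ 1` on the tensor power, and
equivariance turns it into the scalar by which `Q ⊗ 1` acts on the target. -/
theorem polyTensorMap_sum_inVar_mul (hr : 1 ≤ r)
    (hw : IsHighestWeight (zeroMultiset r n d) V v) (Q : MvPolynomial (Fin d) ℂ)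
    (q : MultiPoly n d) : polyTensorMap r n d v ((∑ k, inVar k Q) * q) =
      (n * MvPolynomial.aeval (0 : Fin d → ℂ) Q : ℂ) • polyTensorMap r n d v q := by
  refine LinearMap.ext fun t => ?_
  have h := weylMap_equivariant hw.integrable hw.nilpotent hw.lie_coroot hr (Q ⊗ₜ 1)
    (gather n d (VecRep r) q t)
  have h1 : ∀ k : Fin n, actAt n k (1 : Module.End ℂ (VecRep r)) = LinearMap.id := fun k => by
    refine PiTensorProduct.ext (MultilinearMap.ext fun u => ?_)
    simp [actAt_tprod]
  rw [derivTensor_gather, glRep_tmul_one, map_sum] at h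
  simp only [map_one, h1, LinearMap.id_apply] at h
  rw [Finset.sum_mul, map_sum, LinearMap.sum_apply, LinearMap.smul_apply]
  exact h

/-- The polynomials that act through their value at the origin form a subspace containing `1` and
stable under multiplication by power sums, hence containing all invariants. -/
theorem polyTensorMap_mul_of_mem_invariantPoly (hr : 1 ≤ r)
    (hw : IsHighestWeight (zeroMultiset r n d) V v) {s : MultiPoly n d}
    (hs : s ∈ invariantPoly n d ⊤) (q : MultiPoly n d) : polyTensorMap r n d v (s * q) =
      (MvPolynomial.aeval (0 : Fin n × Fin d → ℂ) s) • polyTensorMap r n d v q := by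
  let N : Submodule ℂ (MultiPoly n d) :=
    { carrier := {s | ∀ q, polyTensorMap r n d v (s * q) =
        (MvPolynomial.aeval (0 : Fin n × Fin d → ℂ) s) • polyTensorMap r n d v q}
      zero_mem' := fun q => by rw [zero_mul, map_zero, map_zero, zero_smul]
      add_mem' := fun {s s'} h h' q => by
        rw [add_mul, map_add, h, h', map_add, add_smul]
      smul_mem' := fun c s h q => by
        rw [smul_mul_assoc, map_smul, h, map_smul, smul_eq_mul, mul_smul] }
  refine mem_of_mem_invariantPoly N (fun q => ?_) (fun Q s h q => ?_) hs q
  · rw [one_mul, map_one, one_smul]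
  · rw [mul_assoc, polyTensorMap_sum_inVar_mul hr hw, h q, map_mul, smul_smul, map_sum,
      Finset.sum_congr rfl fun k _ => aeval_inVar k Q, Finset.sum_const, Finset.card_univ,
      Fintype.card_fin, nsmul_eq_mul]

theorem polyTensorMap_eq_zero (hr : 1 ≤ r)
    (hw : IsHighestWeight (zeroMultiset r n d) V v) {p : MultiPoly n d}
    (hp : p ∈ coinvIdeal n d) : polyTensorMap r n d v p = 0 := by
  -- The extra factor `q` makes the condition on `p` pass to multiples, as an induction over an
  -- ideal requires.
  suffices h : ∀ q, polyTensorMap r n d v (p * q) = 0 by simpa using h 1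
  refine Submodule.span_induction (p := fun p _ => ∀ q, polyTensorMap r n d v (p * q) = 0)
    (fun s hs q => ?_) (fun q => ?_) (fun s s' _ _ h h' q => ?_) (fun c s _ h q => ?_) hp
  · rw [polyTensorMap_mul_of_mem_invariantPoly hr hw hs.1, hs.2, zero_smul]
  · rw [zero_mul, map_zero]
  · rw [add_mul, map_add, h, h', add_zero]
  · rw [smul_eq_mul, mul_comm c s, mul_assoc, h]

/-- The map `V_{r+1}^{⊗n} ⊗ π → V` to a highest weight module, for the coinvariants `π`. -/
def coinvTensorMap (hr : 1 ≤ r) (hw : IsHighestWeight (zeroMultiset r n d) V v) :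
    CoinvTensor r n d →ₗ[ℂ] V :=
  TensorProduct.lift (LinearMap.flip
    (Submodule.liftQ ((coinvIdeal n d).restrictScalars ℂ) (polyTensorMap r n d v)
      fun _ hp => polyTensorMap_eq_zero hr hw hp : Coinv n d →ₗ[ℂ] TPow n (VecRep r) →ₗ[ℂ] V))

theorem coinvTensorMap_pureTensor (hr : 1 ≤ r) (hw : IsHighestWeight (zeroMultiset r n d) V v)
    (w : Fin n → MvPolynomial (Fin d) ℂ × VecRep r) :
    coinvTensorMap hr hw (pureTensor w) = weylMap n (MvPolynomial.aeval (0 : Fin d → ℂ)) v n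
      (PiTensorProduct.tprod ℂ fun k => (w k).1 ⊗ₜ (w k).2) := by
  rw [← gather_prodPoly_tprod]
  rfl

theorem coinvTensorMap_curAct (hr : 1 ≤ r) (hw : IsHighestWeight (zeroMultiset r n d) V v)
    (b : MvPolynomial (Fin d) ℂ ⊗[ℂ] Mat r) (t : CoinvTensor r n d) :
    coinvTensorMap hr hw (curAct r n d b t) =
      glRep r V n (MvPolynomial.aeval (0 : Fin d → ℂ)) b (coinvTensorMap hr hw t) := by
  induction b using TensorProduct.induction_on with
  | zero => simp
  | add b c h h' => simp only [map_add, LinearMap.add_apply, h, h']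
  | tmul P x =>
    revert t
    refine LinearMap.congr_fun (f := coinvTensorMap hr hw ∘ₗ curAct r n d (P ⊗ₜ x))
      (g := glRep r V n (MvPolynomial.aeval (0 : Fin d → ℂ)) (P ⊗ₜ x) ∘ₗ coinvTensorMap hr hw) ?_
    refine hom_ext_pureTensor fun Q j => ?_
    simp only [LinearMap.comp_apply, curAct_pureTensor, map_sum, coinvTensorMap_pureTensor]
    rw [← weylMap_equivariant hw.integrable hw.nilpotent hw.lie_coroot hr, derivTensor_tprod,
      map_sum]
    refine Finset.sum_congr rfl fun k _ => congrArg _ (congrArg _ ?_)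
    funext l
    by_cases h : l = k
    · subst h; simp [glAct_tmul]
    · simp [h]

theorem glRep_curIncl (b : Current r (MvPolynomial (Fin d) ℂ)) (w : V) :
    glRep r V n (MvPolynomial.aeval (0 : Fin d → ℂ)) (curIncl r d b) w = ⁅b, w⁆ := by
  induction b using TensorProduct.induction_on with
  | zero => simp
  | add b c h h' => rw [map_add, map_add, LinearMap.add_apply, h, h', add_lie]
  | tmul P x => exact glRep_tmul_coe n _ P x w

/-- The equivariant map sends the highest weight vector to `n! v`, whence the factor `1 / n!`.
Surjectivity is automatic, since the image is a submodule containing the generator. -/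
theorem IsHighestWeight.exists_hom (hr : 1 ≤ r)
    (hw : IsHighestWeight (zeroMultiset r n d) V v) :
    ∃ f : Frobenius r (coinvAction n d) →ₗ⁅ℂ, Current r (MvPolynomial (Fin d) ℂ)⁆ V,
      f (frobeniusVector r n d) = v ∧ Surjective f := by
  let f : Frobenius r (coinvAction n d) →ₗ⁅ℂ, Current r (MvPolynomial (Fin d) ℂ)⁆ V :=
    { toLinearMap := (n.factorial : ℂ)⁻¹ •
        (coinvTensorMap hr hw ∘ₗ (Frobenius r (coinvAction n d)).subtype)
      map_lie' := fun {x t} => by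
        change (n.factorial : ℂ)⁻¹ • coinvTensorMap hr hw (curAct r n d (curIncl r d x) t.val) =
          ⁅x, (n.factorial : ℂ)⁻¹ • coinvTensorMap hr hw t.val⁆
        rw [coinvTensorMap_curAct, glRep_curIncl, lie_smul] }
  have hf : f (frobeniusVector r n d) = v := by
    change (n.factorial : ℂ)⁻¹ • coinvTensorMap hr hw (pureTensor fun _ => (1, stdVec r 0)) = v
    rw [coinvTensorMap_pureTensor, weylMap_tprod_stdVec_zero hw.lie_coroot, Nat.descFactorial_self,
      smul_smul, inv_mul_cancel₀ (Nat.cast_ne_zero.2 n.factorial_ne_zero), one_smul]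
  refine ⟨f, hf, ?_⟩
  rw [← LieModuleHom.range_eq_top, eq_top_iff, ← hw.generates, LieSubmodule.lieSpan_le,
    Set.singleton_subset_iff]
  exact ⟨_, hf⟩

end MapToHighestWeight

/-! ### Cyclic modules -/

section Cyclic

variable {r : ℕ} {A : Type*} [CommRing A] [Algebra ℂ A]

theorem exists_cyclic_equiv {W : Type*} [AddCommGroup W] [Module ℂ W]
    [LieRingModule (Current r A) W] [LieModule ℂ (Current r A) W] {w : W}
    (hgen : LieSubmodule.lieSpan ℂ (Current r A) {w} = ⊤) :
    ∃ (I : Ideal (Env r A)) (e : Cyclic I ≃ₗ⁅ℂ, Current r A⁆ W), e (Cyclic.gen I) = w := by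
  let ρ : Env r A →ₐ[ℂ] Module.End ℂ W :=
    UniversalEnvelopingAlgebra.lift ℂ (LieModule.toEnd ℂ (Current r A) W)
  let _ : Module (Env r A) W := Module.compHom W ρ.toRingHom
  have hι : ∀ (x : Current r A) (u : W), UniversalEnvelopingAlgebra.ι ℂ x • u = ⁅x, u⁆ := by
    intro x u
    change ρ (UniversalEnvelopingAlgebra.ι ℂ x) u = _
    rw [UniversalEnvelopingAlgebra.lift_ι_apply, LieModule.toEnd_apply_apply]
  have : IsScalarTower ℂ (Env r A) W := ⟨fun c x u => by
    change ρ (c • x) u = c • ρ x u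
    rw [map_smul, LinearMap.smul_apply]⟩
  let f : Env r A →ₗ[Env r A] W := LinearMap.toSpanSingleton (Env r A) W w
  have hf : Surjective f := by
    let N : LieSubmodule ℂ (Current r A) W :=
      { (LinearMap.range f).restrictScalars ℂ with
        lie_mem := fun {x u} hu => by
          change _ ∈ LinearMap.range f
          rw [← hι]
          exact (LinearMap.range f).smul_mem _ hu }
    have hN : N = ⊤ := by
      rw [eq_top_iff, ← hgen, LieSubmodule.lieSpan_le, Set.singleton_subset_iff]
      exact ⟨1, by simp [f]⟩
    intro u
    have : u ∈ N := hN ▸ LieSubmodule.mem_top u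
    exact this
  let e := f.quotKerEquivOfSurjective hf
  refine ⟨LinearMap.ker f, { (e.restrictScalars ℂ : Cyclic (LinearMap.ker f) ≃ₗ[ℂ] W) with
    map_lie' := fun {x u} => ?_ }, ?_⟩
  · exact (e.map_smul (UniversalEnvelopingAlgebra.ι ℂ x) (u : Env r A ⧸ LinearMap.ker f)).trans
      (hι x _)
  · change f 1 = w
    simp [f]

/-- The universal property gives a map from the enveloping algebra into `S` that, followed by the
inclusion, is the identity on generators. -/
theorem env_subalgebra_eq_top (S : Subalgebra ℂ (Env r A))
    (h : ∀ x, UniversalEnvelopingAlgebra.ι ℂ x ∈ S) : S = ⊤ := by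
  let g : Current r A →ₗ⁅ℂ⁆ S :=
    { toFun := fun x => ⟨UniversalEnvelopingAlgebra.ι ℂ x, h x⟩
      map_add' := fun x y => Subtype.ext (map_add _ x y)
      map_smul' := fun c x => Subtype.ext (map_smul _ c x)
      map_lie' := fun {x y} => Subtype.ext (LieHom.map_lie _ x y) }
  have hg : S.val.comp (UniversalEnvelopingAlgebra.lift ℂ g) = AlgHom.id ℂ _ := by
    refine UniversalEnvelopingAlgebra.hom_ext ℂ (LieHom.ext fun x => ?_)
    change ((UniversalEnvelopingAlgebra.lift ℂ g (UniversalEnvelopingAlgebra.ι ℂ x) : S) :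
      Env r A) = UniversalEnvelopingAlgebra.ι ℂ x
    rw [UniversalEnvelopingAlgebra.lift_ι_apply]
    rfl
  refine Algebra.eq_top_iff.2 fun x => ?_
  have := AlgHom.congr_fun hg x
  rw [AlgHom.id_apply] at this
  rw [← this]
  exact (UniversalEnvelopingAlgebra.lift ℂ g x).2

theorem Cyclic.hom_smul {I J : Ideal (Env r A)} (g : Cyclic I →ₗ⁅ℂ, Current r A⁆ Cyclic J)
    (x : Env r A) (w : Cyclic I) : g (x • w) = x • g w := by
  let S : Subalgebra ℂ (Env r A) :=
    { carrier := {x | ∀ w, g (x • w) = x • g w}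
      mul_mem' := fun {x y} hx hy w => by rw [mul_smul, hx, hy, mul_smul]
      add_mem' := fun {x y} hx hy w => by rw [add_smul, map_add, hx, hy, add_smul]
      algebraMap_mem' := fun c w => by
        rw [algebraMap_smul, algebraMap_smul, map_smul] }
  have hS : S = ⊤ := env_subalgebra_eq_top S fun x w => g.map_lie x w
  exact (hS ▸ Algebra.mem_top : x ∈ S) w

theorem Cyclic.smul_gen_eq_zero {I : Ideal (Env r A)} {x : Env r A} :
    x • Cyclic.gen I = 0 ↔ x ∈ I := by
  change (Submodule.Quotient.mk (x • 1) : Env r A ⧸ I) = 0 ↔ _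
  rw [Submodule.Quotient.mk_eq_zero, smul_eq_mul, mul_one]

/-- The ideal is the annihilator of the generator, and annihilators grow along homomorphisms. This
turns maximality of modules into minimality of ideals. -/
theorem Cyclic.le_of_hom {I J : Ideal (Env r A)} (g : Cyclic I →ₗ⁅ℂ, Current r A⁆ Cyclic J)
    (hg : g (Cyclic.gen I) = Cyclic.gen J) : I ≤ J := fun x hx => by
  rw [← Cyclic.smul_gen_eq_zero, ← hg, ← Cyclic.hom_smul, Cyclic.smul_gen_eq_zero.2 hx, map_zero]

theorem equiv_lie {W W' : Type*} [AddCommGroup W] [Module ℂ W]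
    [LieRingModule (Current r A) W] [LieModule ℂ (Current r A) W] [AddCommGroup W'] [Module ℂ W']
    [LieRingModule (Current r A) W'] [LieModule ℂ (Current r A) W']
    (e : W ≃ₗ⁅ℂ, Current r A⁆ W') (x : Current r A) (w : W) : e ⁅x, w⁆ = ⁅x, e w⁆ :=
  e.toLieModuleHom.map_lie x w

theorem mem_weightSpace_of_equiv {W W' : Type*} [AddCommGroup W] [Module ℂ W]
    [LieRingModule (Current r A) W] [LieModule ℂ (Current r A) W] [AddCommGroup W'] [Module ℂ W']
    [LieRingModule (Current r A) W'] [LieModule ℂ (Current r A) W']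
    (e : W ≃ₗ⁅ℂ, Current r A⁆ W') (μ : Fin r → ℤ) (w : W) :
    e w ∈ weightSpace r A W' μ ↔ w ∈ weightSpace r A W μ := by
  refine forall_congr' fun i => ?_
  rw [← equiv_lie, ← e.toLinearEquiv.injective.eq_iff]
  change _ ↔ e _ = e.toLinearEquiv _
  rw [map_smul]
  rfl

theorem IsHighestWeight.of_equiv {W W' : Type*} [AddCommGroup W] [Module ℂ W]
    [LieRingModule (Current r A) W] [LieModule ℂ (Current r A) W] [AddCommGroup W'] [Module ℂ W']
    [LieRingModule (Current r A) W'] [LieModule ℂ (Current r A) W']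
    {lam : Fin r → ℕ} {Z : PointMultiset r A lam} {w : W} {w' : W'}
    (h : IsHighestWeight Z W w) (e : W ≃ₗ⁅ℂ, Current r A⁆ W') (he : e w = w') :
    IsHighestWeight Z W' w' where
  integrable := by
    obtain ⟨D, hD⟩ := h.integrable
    refine ⟨D, ?_⟩
    have hle : ⊤ ≤ (⨆ μ ∈ D, weightSpace r A W' μ).comap e.toLinearEquiv.toLinearMap := by
      rw [← hD]
      refine iSup₂_le fun μ hμ x hx => ?_
      exact Submodule.mem_iSup_of_mem μ (Submodule.mem_iSup_of_mem hμ
        ((mem_weightSpace_of_equiv e μ x).2 hx))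
    refine Submodule.eq_top_iff'.2 fun x => ?_
    obtain ⟨y, rfl⟩ := e.toLinearEquiv.surjective x
    exact hle (Submodule.mem_top (x := y))
  generates := by
    set N := LieSubmodule.lieSpan ℂ (Current r A) {w'}
    have hle : ⊤ ≤ N.comap e.toLieModuleHom := by
      rw [← h.generates, LieSubmodule.lieSpan_le, Set.singleton_subset_iff]
      change e w ∈ N
      rw [he]
      exact LieSubmodule.subset_lieSpan rfl
    refine eq_top_iff.2 fun x _ => ?_
    obtain ⟨y, rfl⟩ := e.toLinearEquiv.surjective x
    exact hle (LieSubmodule.mem_top y)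
  nilpotent x hx P := by
    rw [← he, ← equiv_lie, h.nilpotent x hx]
    exact e.toLinearEquiv.map_zero
  cartan i P := by
    rw [← he, ← equiv_lie, h.cartan]
    exact e.toLinearEquiv.map_smul _ _

end Cyclic

/-! ### Identification of the local Weyl module with the Frobenius transform -/

theorem exists_localWeyl_equiv {r : ℕ} (hr : 1 ≤ r) (n d : ℕ) :
    ∃ e : LocalWeyl (zeroMultiset r n d) ≃ₗ⁅ℂ, Current r (MvPolynomial (Fin d) ℂ)⁆
        Frobenius r (coinvAction n d),
      e (weylVector (zeroMultiset r n d)) = frobeniusVector r n d := by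
  obtain ⟨I, e, he⟩ := exists_cyclic_equiv (lieSpan_frobeniusVector (r := r) (n := n) (d := d))
  have hI : IsHighestWeight (zeroMultiset r n d) (Cyclic I) (Cyclic.gen I) :=
    isHighestWeight_frobenius.of_equiv e.symm
      (by rw [← he]; exact e.toLinearEquiv.symm_apply_apply _)
  -- The annihilator `I` of the highest weight vector is one of the ideals in the infimum, and it
  -- lies below each other one because the Frobenius transform maps to every highest weight module.
  have hW : weylIdeal (zeroMultiset r n d) = I := by
    refine le_antisymm (sInf_le hI) (le_sInf fun J hJ => ?_)
    obtain ⟨f, hf, -⟩ := IsHighestWeight.exists_hom hr hJ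
    refine Cyclic.le_of_hom (f.comp e.toLieModuleHom) ?_
    rw [← hf, ← he]
    rfl
  have key : ∀ J, J = I → ∃ e : Cyclic J ≃ₗ⁅ℂ, Current r (MvPolynomial (Fin d) ℂ)⁆
      Frobenius r (coinvAction n d), e (Cyclic.gen J) = frobeniusVector r n d := by
    rintro _ rfl
    exact ⟨e, he⟩
  exact key _ hW

theorem isLocalWeyl_localWeyl.{v} {r : ℕ} (hr : 1 ≤ r) (n d : ℕ) :
    IsLocalWeyl.{v} (zeroMultiset r n d) (LocalWeyl (zeroMultiset r n d))
      (weylVector (zeroMultiset r n d)) := by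
  obtain ⟨e, he⟩ := exists_localWeyl_equiv hr n d
  refine ⟨isHighestWeight_frobenius.of_equiv e.symm
    (by rw [← he]; exact e.toLinearEquiv.symm_apply_apply _), fun V _ _ _ _ v' hV => ?_⟩
  obtain ⟨f, hf, hsurj⟩ := IsHighestWeight.exists_hom hr hV
  refine ⟨f.comp e.toLieModuleHom, ?_, hsurj.comp e.toLinearEquiv.surjective⟩
  rw [← hf, ← he]
  rfl

theorem exists_linearEquiv_frobenius {r : ℕ} (hr : 1 ≤ r) (n d : ℕ) :
    ∃ φ : LocalWeyl (zeroMultiset r n d) ≃ₗ[ℂ] Frobenius r (coinvRep n d),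
      ∀ (x : SL r) (w : LocalWeyl (zeroMultiset r n d)),
        φ ⁅(cur 1 x : Current r (MvPolynomial (Fin d) ℂ)), w⁆ = ⁅x, φ w⁆ := by
  obtain ⟨e, -⟩ := exists_localWeyl_equiv hr n d
  have h : ∃ φ : LocalWeyl (zeroMultiset r n d) ≃ₗ[ℂ] Frobenius r (coinvAction n d),
      ∀ (x : SL r) (w : LocalWeyl (zeroMultiset r n d)),
        φ ⁅(cur 1 x : Current r (MvPolynomial (Fin d) ℂ)), w⁆ = ⁅x, φ w⁆ :=
    ⟨e.toLinearEquiv, fun x w => (equiv_lie e _ w).trans (cur_one_lie x _)⟩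
  exact h

/-! ### Blocks of the Young subgroup -/

section Blocks

variable {r n : ℕ}

theorem sum_Iic_eq (i : Fin (r + 1) → ℕ) (j : Fin (r + 1)) :
    ∑ l ∈ Finset.Iic j, i l = ∑ l ∈ Finset.Iio j, i l + i j := by
  rw [← Finset.Iio_insert, Finset.sum_insert (by simp), add_comm]

theorem sum_Iic_le {i : Fin (r + 1) → ℕ} (hi : ∑ j, i j = n) (j : Fin (r + 1)) :
    ∑ l ∈ Finset.Iic j, i l ≤ n :=
  hi ▸ Finset.sum_le_sum_of_subset (Finset.subset_univ _)

theorem exists_blockIndex {i : Fin (r + 1) → ℕ} (hi : ∑ j, i j = n) :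
    ∃ b : Fin n → Fin (r + 1), ∀ k j, b k = j ↔
      ∑ l ∈ Finset.Iio j, i l ≤ k.val ∧ k.val < ∑ l ∈ Finset.Iic j, i l := by
  have hex : ∀ k : Fin n, ∃ j, ∑ l ∈ Finset.Iio j, i l ≤ k.val ∧
      k.val < ∑ l ∈ Finset.Iic j, i l := by
    intro k
    by_contra hcon
    push Not at hcon
    have hall : ∀ j : Fin (r + 1), ∑ l ∈ Finset.Iic j, i l ≤ k.val := by
      intro j
      induction j using Fin.induction with
      | zero =>
        refine hcon 0 (le_of_eq_of_le (Finset.sum_eq_zero fun l hl => ?_) (Nat.zero_le _))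
        exact absurd (Finset.mem_Iio.1 hl) (Fin.not_lt_zero l)
      | succ j ih =>
        -- The blocks abut: the lengths strictly before block `j + 1` are those up to and including
        -- block `j`. A position in no block would thus lie beyond all of them, at `n` or later.
        refine hcon _ ?_
        convert ih using 2
        ext l
        simp [Fin.lt_def, Fin.le_def]
    have := hall (Fin.last r)
    rw [show Finset.Iic (Fin.last r) = Finset.univ from
      Finset.eq_univ_of_forall fun l => Finset.mem_Iic.2 (Fin.le_last l), hi] at this
    exact absurd k.2 (not_lt.2 this)
  have huniq : ∀ (k : Fin n) (j j' : Fin (r + 1)), ∑ l ∈ Finset.Iio j', i l ≤ k.val →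
      k.val < ∑ l ∈ Finset.Iic j, i l → j' ≤ j := by
    intro k j j' h h'
    by_contra hlt
    refine absurd (lt_of_lt_of_le h' (le_trans ?_ h)) (lt_irrefl _)
    refine Finset.sum_le_sum_of_subset fun l hl => ?_
    rw [Finset.mem_Iio]
    exact lt_of_le_of_lt (Finset.mem_Iic.1 hl) (not_le.1 hlt)
  choose b hb using hex
  refine ⟨b, fun k j => ⟨?_, fun h => ?_⟩⟩
  · rintro rfl
    exact hb k
  · exact le_antisymm (huniq k j (b k) (hb k).1 h.2) (huniq k (b k) j h.1 (hb k).2)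

theorem card_blockIndex {i : Fin (r + 1) → ℕ} (hi : ∑ j, i j = n) {b : Fin n → Fin (r + 1)}
    (hb : ∀ k j, b k = j ↔ ∑ l ∈ Finset.Iio j, i l ≤ k.val ∧ k.val < ∑ l ∈ Finset.Iic j, i l)
    (j : Fin (r + 1)) : (Finset.univ.filter fun k => b k = j).card = i j := by
  have h : (Finset.univ.filter fun k => b k = j).map Fin.valEmbedding =
      Finset.Ico (∑ l ∈ Finset.Iio j, i l) (∑ l ∈ Finset.Iic j, i l) := by
    ext m
    simp only [Finset.mem_map, Finset.mem_filter, Finset.mem_univ, true_and, hb,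
      Fin.valEmbedding_apply, Finset.mem_Ico]
    refine ⟨?_, fun h => ⟨⟨m, lt_of_lt_of_le h.2 (sum_Iic_le hi j)⟩, h, rfl⟩⟩
    rintro ⟨k, hk, rfl⟩
    exact hk
  rw [← Finset.card_map Fin.valEmbedding, h, Nat.card_Ico, sum_Iic_eq, add_tsub_cancel_left]

theorem mem_youngSubgroup {i : Fin (r + 1) → ℕ} {b : Fin n → Fin (r + 1)}
    (hb : ∀ k j, b k = j ↔ ∑ l ∈ Finset.Iio j, i l ≤ k.val ∧ k.val < ∑ l ∈ Finset.Iic j, i l)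
    (σ : Equiv.Perm (Fin n)) : σ ∈ youngSubgroup i ↔ b ∘ σ = b := by
  simp only [youngSubgroup, Subgroup.mem_iInf, MulAction.mem_stabilizer_iff, ← hb]
  refine ⟨fun h => funext fun k => ?_, fun h j => ?_⟩
  · have hk : σ • k ∈ σ • {l | b l = b k} := Set.smul_mem_smul_set rfl
    rw [h (b k)] at hk
    exact hk
  · ext k
    rw [Set.mem_smul_set_iff_inv_smul_mem]
    have := congrFun h (σ⁻¹ k)
    have h' : b k = b (σ⁻¹ k) := (congrArg b (σ.apply_symm_apply k)).symm.trans this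
    rw [Set.mem_ofPred_eq, Set.mem_ofPred_eq, h', Equiv.Perm.smul_def]

theorem indexWeight_eq (j : Fin n → Fin (r + 1)) (i : Fin r) : indexWeight j i =
    ((Finset.univ.filter fun k => j k = i.castSucc).card : ℤ) -
      ((Finset.univ.filter fun k => j k = i.succ).card : ℤ) := by
  rw [indexWeight, Finset.sum_sub_distrib, Finset.sum_boole, Finset.sum_boole]

/-- The weight fixes the differences of consecutive multiplicities, so the discrepancy from `i` is
the same for every index. Both families sum to `n`, hence it is zero. -/
theorem card_eq_of_indexWeight_eq {i : Fin (r + 1) → ℕ} (hi : ∑ j, i j = n)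
    {j : Fin n → Fin (r + 1)} (h : indexWeight j = diffWeight i) (l : Fin (r + 1)) :
    (Finset.univ.filter fun k => j k = l).card = i l := by
  set c : Fin (r + 1) → ℕ := fun l => (Finset.univ.filter fun k => j k = l).card with hc
  have hsum : ∑ l, c l = n := by
    have := Finset.card_eq_sum_card_fiberwise (s := Finset.univ) (t := Finset.univ) (f := j)
      (fun _ _ => Finset.mem_coe.2 (Finset.mem_univ _))
    simpa [hc] using this.symm
  have hdiff : ∀ l : Fin (r + 1), (c l : ℤ) - i l = c 0 - i 0 := by
    intro l
    induction l using Fin.induction with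
    | zero => rfl
    | succ l ih =>
      have := congrFun h l
      rw [indexWeight_eq, diffWeight] at this
      change (c l.castSucc : ℤ) - c l.succ = _ at this
      omega
  have h0 : ((r : ℤ) + 1) * (c 0 - i 0) = 0 := by
    have : ∑ l, ((c l : ℤ) - i l) = 0 := by
      rw [Finset.sum_sub_distrib, ← Nat.cast_sum, ← Nat.cast_sum, hsum, hi, sub_self]
    rw [Finset.sum_congr rfl fun l _ => hdiff l] at this
    rw [Finset.sum_const, Finset.card_univ, Fintype.card_fin, nsmul_eq_mul] at this
    push_cast at this
    exact this
  have h1 : (c 0 : ℤ) - i 0 = 0 := (mul_eq_zero.1 h0).resolve_left (by positivity)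
  have := hdiff l
  change c l = i l
  omega

theorem exists_perm_of_card_eq {j j' : Fin n → Fin (r + 1)}
    (h : ∀ l, (Finset.univ.filter fun k => j k = l).card =
      (Finset.univ.filter fun k => j' k = l).card) : ∃ σ : Equiv.Perm (Fin n), j' ∘ σ = j := by
  have e : ∀ l, Nonempty ({k // j k = l} ≃ {k // j' k = l}) := fun l =>
    Fintype.card_eq.1 (by rw [Fintype.card_subtype, Fintype.card_subtype, h])
  exact ⟨Equiv.ofFiberEquiv fun l => (e l).some, funext fun k => Equiv.ofFiberEquiv_map _ k⟩

end Blocks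

/-! ### Averages over a subgroup -/

section Average

variable {n d : ℕ} (H : Subgroup (Equiv.Perm (Fin n)))

open Classical in
/-- The sum over a subgroup of the symmetric group. -/
def groupSum : MultiPoly n d →ₗ[ℂ] invariantPoly n d H :=
  LinearMap.codRestrict (Subalgebra.toSubmodule (invariantPoly n d H))
    (∑ σ : H, (permPoly d σ.val).toLinearMap) fun p τ hτ => by
      rw [LinearMap.sum_apply, map_sum]
      refine Fintype.sum_equiv (Equiv.mulLeft (⟨τ, hτ⟩ : H)) _ _ fun σ => ?_
      exact ((LinearMap.congr_fun ((polyRep n d).map_mul τ σ.val) p)).symm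

open Classical in
theorem coe_groupSum (p : MultiPoly n d) :
    (groupSum H p).val = ∑ σ : H, permPoly d σ.val p :=
  LinearMap.sum_apply _ _ _

theorem groupSum_mul {s : MultiPoly n d} (hs : s ∈ invariantPoly n d H) (q : MultiPoly n d) :
    groupSum H (q * s) = groupSum H q * ⟨s, hs⟩ := by
  classical
  apply Subtype.ext
  rw [MulMemClass.coe_mul, coe_groupSum, coe_groupSum, Finset.sum_mul]
  refine Finset.sum_congr rfl fun σ _ => ?_
  rw [map_mul, hs σ.val σ.2]

open Classical in
theorem groupSum_coe (p : invariantPoly n d H) :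
    groupSum H p.val = (Fintype.card H : ℂ) • p := by
  apply Subtype.ext
  rw [coe_groupSum, Finset.sum_congr rfl fun σ _ => p.2 σ.val σ.2, Finset.sum_const,
    Finset.card_univ, ← Nat.cast_smul_eq_nsmul ℂ]
  rfl

/-- The ideal of the invariant ring is the contraction of the ideal of the full ring. For the
nontrivial direction, summing over `H` is linear over `H`-invariants, so it maps multiples of the
generators into the smaller ideal, and it is a nonzero scalar on invariants. -/
theorem mem_relCoinvIdeal (p : invariantPoly n d H) :
    p ∈ relCoinvIdeal n d H ↔ p.val ∈ coinvIdeal n d := by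
  classical
  constructor
  · intro hp
    have hle : relCoinvIdeal n d H ≤ (coinvIdeal n d).comap (invariantPoly n d H).val :=
      Ideal.span_le.2 fun q hq => Ideal.subset_span hq
    exact hle hp
  · intro hp
    have h : ∀ q, groupSum H (q * p.val) ∈ relCoinvIdeal n d H := by
      refine Submodule.span_induction
        (p := fun s _ => ∀ q, groupSum H (q * s) ∈ relCoinvIdeal n d H)
        (fun s hs q => ?_) (fun q => ?_) (fun s s' _ _ h h' q => ?_) (fun c s _ h q => ?_) hp
      · have hsH : s ∈ invariantPoly n d H := fun σ _ => hs.1 σ (Subgroup.mem_top σ)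
        rw [groupSum_mul H hsH]
        exact Ideal.mul_mem_left _ _ (Ideal.subset_span hs)
      · rw [mul_zero, map_zero]; exact Ideal.zero_mem _
      · rw [mul_add, map_add]; exact Ideal.add_mem _ (h q) (h' q)
      · rw [smul_eq_mul, ← mul_assoc]; exact h _
    have h1 := h 1
    rw [one_mul, groupSum_coe] at h1
    have hc : (Fintype.card H : ℂ) ≠ 0 := Nat.cast_ne_zero.2 Fintype.card_ne_zero
    have h2 := ((relCoinvIdeal n d H).restrictScalars ℂ).smul_mem (Fintype.card H : ℂ)⁻¹ h1
    rwa [inv_smul_smul₀ hc] at h2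

end Average

/-! ### Weight spaces -/

section Coordinates

variable {r n d : ℕ}

/-- The coefficient of `e_{j_1} ⊗ ⋯ ⊗ e_{j_n}`. -/
def coordMap (j : Fin n → Fin (r + 1)) : CoinvTensor r n d →ₗ[ℂ] Coinv n d :=
  (TensorProduct.lid ℂ (Coinv n d)).toLinearMap ∘ₗ LinearMap.rTensor (Coinv n d)
    (PiTensorProduct.lift ((MultilinearMap.mkPiAlgebra ℂ (Fin n) ℂ).compLinearMap
      fun k => (stdBasis r).coord (j k)))

theorem coordMap_tmul (j j' : Fin n → Fin (r + 1)) (c : Coinv n d) :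
    coordMap j ((PiTensorProduct.tprod ℂ fun k => stdVec r (j' k)) ⊗ₜ c) =
      if j = j' then c else 0 := by
  have h : (∏ k, (stdBasis r).coord (j k) (stdVec r (j' k))) = if j = j' then 1 else 0 := by
    simp only [← stdBasis_apply, Module.Basis.coord_apply, Module.Basis.repr_self,
      Finsupp.single_apply]
    split_ifs with h
    · subst h; simp
    · obtain ⟨k, hk⟩ := Function.ne_iff.1 h
      exact Finset.prod_eq_zero (Finset.mem_univ k) (if_neg (Ne.symm hk))
  simp only [coordMap, LinearMap.comp_apply, LinearMap.rTensor_tmul, PiTensorProduct.lift.tprod,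
    MultilinearMap.compLinearMap_apply, MultilinearMap.mkPiAlgebra_apply,
    LinearEquiv.coe_coe, TensorProduct.lid_tmul, h]
  split_ifs <;> simp

theorem coordMap_pureTensor (j j' : Fin n → Fin (r + 1)) (P : Fin n → MvPolynomial (Fin d) ℂ) :
    coordMap j (pureTensor fun k => (P k, stdVec r (j' k))) =
      if j = j' then toCoinv n d (prodPoly n d P) else 0 :=
  coordMap_tmul j j' _

theorem sum_coordMap (t : CoinvTensor r n d) :
    ∑ j : Fin n → Fin (r + 1), (PiTensorProduct.tprod ℂ fun k => stdVec r (j k)) ⊗ₜ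
      coordMap j t = t := by
  have h : (∑ j : Fin n → Fin (r + 1), (TensorProduct.mk ℂ (TPow n (VecRep r)) (Coinv n d)
      (PiTensorProduct.tprod ℂ fun k => stdVec r (j k))) ∘ₗ coordMap j) = LinearMap.id := by
    refine hom_ext_pureTensor fun P j' => ?_
    rw [LinearMap.sum_apply, Finset.sum_eq_single j']
    · rw [LinearMap.comp_apply, coordMap_pureTensor, if_pos rfl]
      rfl
    · intro j _ hj
      rw [LinearMap.comp_apply, coordMap_pureTensor, if_neg hj, map_zero]
    · simp
  simpa [LinearMap.sum_apply] using LinearMap.congr_fun h t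

theorem coordMap_tensorRep (σ : Equiv.Perm (Fin n)) (j : Fin n → Fin (r + 1))
    (t : CoinvTensor r n d) : coordMap j (tensorRep r (coinvAction n d) σ t) =
      coinvAction n d σ (coordMap (j ∘ σ) t) := by
  revert t
  refine LinearMap.congr_fun (f := coordMap j ∘ₗ tensorRep r (coinvAction n d) σ)
    (g := coinvAction n d σ ∘ₗ coordMap (j ∘ σ)) (hom_ext_pureTensor fun P j' => ?_)
  rw [LinearMap.comp_apply, LinearMap.comp_apply, tensorRep_pureTensor, coordMap_pureTensor]
  refine (coordMap_pureTensor j (j' ∘ σ.symm) (P ∘ σ.symm)).trans ?_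
  have h : j = j' ∘ σ.symm ↔ j ∘ σ = j' := Equiv.eq_comp_symm σ j j'
  by_cases hj : j ∘ σ = j'
  · rw [if_pos hj, if_pos (h.2 hj), coinvAction_toCoinv, permPoly_prodPoly]
  · rw [if_neg hj, if_neg (fun e => hj (h.1 e)), map_zero]

theorem coordMap_coroot (i : Fin r) (j : Fin n → Fin (r + 1)) (t : CoinvTensor r n d) :
    coordMap j (curAct r n d (1 ⊗ₜ (coroot r i).val) t) =
      ((indexWeight j i : ℤ) : ℂ) • coordMap j t := by
  rw [curAct_one_tmul]
  revert t
  refine LinearMap.congr_fun (f := coordMap j ∘ₗ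
      (derivTensor n (VecRep r) (matAct r (coroot r i).val)).rTensor (Coinv n d))
    (g := ((indexWeight j i : ℤ) : ℂ) • coordMap j) (hom_ext_pureTensor fun P j' => ?_)
  rw [LinearMap.comp_apply, LinearMap.smul_apply, coordMap_pureTensor, pureTensor,
    LinearMap.rTensor_tmul, derivTensor_coroot, ← TensorProduct.smul_tmul', map_smul,
    coordMap_tmul]
  by_cases h : j = j'
  · subst h; simp
  · simp [h]

variable {i : Fin (r + 1) → ℕ} {b : Fin n → Fin (r + 1)}

/-- Coefficients at basis tensors of another weight vanish by the weight equation. Basis tensors of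
the given weight form one `Σ_n`-orbit, and invariance transports the vanishing at `b` along it. -/
theorem eq_zero_of_coordMap_eq_zero (hi : ∑ j, i j = n)
    (hb : ∀ k j, b k = j ↔ ∑ l ∈ Finset.Iio j, i l ≤ k.val ∧ k.val < ∑ l ∈ Finset.Iic j, i l)
    {t : Frobenius r (coinvAction n d)}
    (ht : t ∈ weightSpace r (MvPolynomial (Fin d) ℂ) (Frobenius r (coinvAction n d))
      (diffWeight i)) (h0 : coordMap b t.val = 0) : t = 0 := by
  apply Subtype.ext
  rw [← sum_coordMap t.val]
  refine Finset.sum_eq_zero fun j _ => ?_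
  suffices h : coordMap j t.val = 0 by rw [h, TensorProduct.tmul_zero]
  by_cases hj : indexWeight j = diffWeight i
  · obtain ⟨σ, hσ⟩ := exists_perm_of_card_eq (j := j) (j' := b) fun l => by
      rw [card_eq_of_indexWeight_eq hi hj, card_blockIndex hi hb]
    have h1 := coordMap_tensorRep σ b t.val
    rw [t.property σ, h0, hσ] at h1
    have h2 := congrArg (coinvAction n d σ⁻¹) h1
    rw [map_zero, ← Module.End.mul_apply, ← map_mul, inv_mul_cancel, map_one] at h2
    exact h2.symm
  · obtain ⟨l, hl⟩ := Function.ne_iff.1 hj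
    have h1 := congrArg (fun s : Frobenius r (coinvAction n d) => coordMap j s.val) (ht l)
    simp only [coe_lie_coinv, curIncl_cur, coordMap_coroot, Submodule.coe_smul, map_smul] at h1
    rw [← sub_eq_zero, ← sub_smul] at h1
    refine (smul_eq_zero.1 h1).resolve_left (sub_ne_zero.2 fun e => hl ?_)
    exact_mod_cast e

variable (d) in
/-- The map `p ↦ ∑ σ (e_b ⊗ p)` for the basis vector `e_b` of `V_{r+1}^{⊗n}` of index `b`. -/
def weightMap (H : Subgroup (Equiv.Perm (Fin n))) (b : Fin n → Fin (r + 1)) :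
    invariantPoly n d H →ₗ[ℂ] Frobenius r (coinvAction n d) :=
  symmetrize r n d ∘ₗ TensorProduct.mk ℂ (TPow n (VecRep r)) (Coinv n d)
    (PiTensorProduct.tprod ℂ fun k => stdVec r (b k)) ∘ₗ toCoinv n d ∘ₗ
      (invariantPoly n d H).val.toLinearMap

theorem weightMap_apply (H : Subgroup (Equiv.Perm (Fin n))) (b : Fin n → Fin (r + 1))
    (p : invariantPoly n d H) : weightMap d H b p = symmetrize r n d
      ((PiTensorProduct.tprod ℂ fun k => stdVec r (b k)) ⊗ₜ toCoinv n d p.val) := rfl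

theorem weightMap_mem (hi : ∑ j, i j = n)
    (hb : ∀ k j, b k = j ↔ ∑ l ∈ Finset.Iio j, i l ≤ k.val ∧ k.val < ∑ l ∈ Finset.Iic j, i l)
    (p : invariantPoly n d (youngSubgroup i)) : weightMap d (youngSubgroup i) b p ∈
      weightSpace r (MvPolynomial (Fin d) ℂ) (Frobenius r (coinvAction n d)) (diffWeight i) := by
  have hwt : indexWeight b = diffWeight i := funext fun l => by
    rw [indexWeight_eq, card_blockIndex hi hb, card_blockIndex hi hb, diffWeight]
  intro l
  apply Subtype.ext
  rw [coe_lie_coinv, curIncl_cur, weightMap_apply, ← coe_symmetrize_curAct, curAct_one_tmul,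
    LinearMap.rTensor_tmul, derivTensor_coroot, ← TensorProduct.smul_tmul', map_smul, hwt]

/-- Among the permuted copies of `e_b`, only those moved by the Young subgroup are `e_b` again, and
each contributes the same invariant. The constant is the order of that subgroup. -/
theorem coordMap_weightMap
    (hb : ∀ k j, b k = j ↔ ∑ l ∈ Finset.Iio j, i l ≤ k.val ∧ k.val < ∑ l ∈ Finset.Iic j, i l)
    (p : invariantPoly n d (youngSubgroup i)) :
    ∃ c : ℂ, c ≠ 0 ∧ coordMap b (weightMap d (youngSubgroup i) b p).val =
      c • toCoinv n d p.val := by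
  classical
  refine ⟨((Finset.univ.filter fun σ : Equiv.Perm (Fin n) => σ ∈ youngSubgroup i).card : ℂ),
    Nat.cast_ne_zero.2 (Finset.card_ne_zero.2 ⟨1, by simp [one_mem]⟩), ?_⟩
  rw [weightMap_apply, coe_symmetrize, map_sum, Nat.cast_smul_eq_nsmul, ← Finset.sum_const,
    Finset.sum_filter]
  refine Finset.sum_congr rfl fun σ _ => ?_
  rw [coordMap_tensorRep, coordMap_tmul]
  by_cases h : σ ∈ youngSubgroup i
  · rw [if_pos h, if_pos ((mem_youngSubgroup hb σ).1 h), coinvAction_toCoinv, p.2 σ h]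
  · rw [if_neg h, if_neg fun e => h ((mem_youngSubgroup hb σ).2 e), map_zero]

theorem ker_weightMap
    (hb : ∀ k j, b k = j ↔ ∑ l ∈ Finset.Iio j, i l ≤ k.val ∧ k.val < ∑ l ∈ Finset.Iic j, i l) :
    LinearMap.ker (weightMap d (youngSubgroup i) b) =
      (relCoinvIdeal n d (youngSubgroup i)).restrictScalars ℂ := by
  ext p
  rw [LinearMap.mem_ker, Submodule.restrictScalars_mem, mem_relCoinvIdeal, ← toCoinv_eq_zero]
  constructor
  · intro h
    obtain ⟨c, hc, h'⟩ := coordMap_weightMap hb p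
    rw [h, Submodule.coe_zero, map_zero] at h'
    exact (smul_eq_zero.1 h'.symm).resolve_left hc
  · intro h
    rw [weightMap_apply, h, TensorProduct.tmul_zero, map_zero]

/-- The coefficient at `b` of an invariant vector is fixed by the Young subgroup, so averaging any
polynomial lift gives an invariant lift up to a scalar. The resulting vector agrees with a multiple
of the given one at `b`, hence everywhere. -/
theorem range_weightMap (hi : ∑ j, i j = n)
    (hb : ∀ k j, b k = j ↔ ∑ l ∈ Finset.Iio j, i l ≤ k.val ∧ k.val < ∑ l ∈ Finset.Iic j, i l) :
    LinearMap.range (weightMap d (youngSubgroup i) b) =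
      weightSpace r (MvPolynomial (Fin d) ℂ) (Frobenius r (coinvAction n d)) (diffWeight i) := by
  classical
  refine le_antisymm (by rintro _ ⟨p, rfl⟩; exact weightMap_mem hi hb p) fun t ht => ?_
  -- The lift `q` need not be invariant; only its class is. Passing to `groupSum` multiplies the
  -- class by the order of the subgroup.
  obtain ⟨q, hq⟩ := toCoinv_surjective (coordMap b t.val)
  have hinv : ∀ σ ∈ youngSubgroup i, toCoinv n d (permPoly d σ q) = coordMap b t.val := by
    intro σ hσ
    have h := coordMap_tensorRep σ b t.val
    rw [t.property σ, (mem_youngSubgroup hb σ).1 hσ] at h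
    rw [← coinvAction_toCoinv, hq, ← h]
  set p := groupSum (youngSubgroup i) q with hp
  have hpc : toCoinv n d p.val = (Fintype.card (youngSubgroup (n := n) i) : ℂ) •
      coordMap b t.val := by
    rw [hp, coe_groupSum, map_sum, Finset.sum_congr rfl fun σ _ => hinv σ.val σ.2,
      Finset.sum_const, Finset.card_univ, Nat.cast_smul_eq_nsmul]
  obtain ⟨c, hc, h⟩ := coordMap_weightMap hb p
  have hcard : (Fintype.card (youngSubgroup (n := n) i) : ℂ) ≠ 0 :=
    Nat.cast_ne_zero.2 Fintype.card_ne_zero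
  set m := c * (Fintype.card (youngSubgroup (n := n) i) : ℂ) with hm
  have hm0 : m ≠ 0 := mul_ne_zero hc hcard
  have h0 : weightMap d (youngSubgroup i) b p - m • t = 0 := by
    have hmem := Submodule.sub_mem (R := ℂ) (M := Frobenius r (coinvAction n d))
      (weightSpace r (MvPolynomial (Fin d) ℂ) (Frobenius r (coinvAction n d)) (diffWeight i))
      (weightMap_mem hi hb p) (Submodule.smul_mem _ m ht)
    refine eq_zero_of_coordMap_eq_zero hi hb hmem ?_
    change coordMap b ((weightMap d (youngSubgroup i) b p).val - m • t.val) = 0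
    rw [map_sub, h, hpc, map_smul, smul_smul]
    exact sub_self _
  have h1 : weightMap d (youngSubgroup i) b p = m • t := sub_eq_zero.1 h0
  exact ⟨m⁻¹ • p, by rw [map_smul, h1, inv_smul_smul₀ hm0]⟩

theorem nonempty_weightSpace_equiv (hr : 1 ≤ r) (n d : ℕ) (i : Fin (r + 1) → ℕ)
    (hi : ∑ j, i j = n) : Nonempty
      (weightSpace r (MvPolynomial (Fin d) ℂ) (LocalWeyl (zeroMultiset r n d)) (diffWeight i)
        ≃ₗ[ℂ] (invariantPoly n d (youngSubgroup i) ⧸ relCoinvIdeal n d (youngSubgroup i))) := by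
  obtain ⟨e, -⟩ := exists_localWeyl_equiv hr n d
  obtain ⟨b, hb⟩ := exists_blockIndex hi
  have hmap : (weightSpace r (MvPolynomial (Fin d) ℂ) (LocalWeyl (zeroMultiset r n d))
      (diffWeight i)).map e.toLinearEquiv.toLinearMap =
        weightSpace r (MvPolynomial (Fin d) ℂ) (Frobenius r (coinvAction n d)) (diffWeight i) := by
    ext t
    obtain ⟨w, rfl⟩ := e.toLinearEquiv.surjective t
    rw [Submodule.mem_map_equiv, LinearEquiv.symm_apply_apply]
    exact (mem_weightSpace_of_equiv e _ w).symm
  have e₁ : weightSpace r (MvPolynomial (Fin d) ℂ) (LocalWeyl (zeroMultiset r n d))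
      (diffWeight i) ≃ₗ[ℂ] LinearMap.range (weightMap d (youngSubgroup i) b) :=
    (e.toLinearEquiv.submoduleMap _).trans (LinearEquiv.ofEq _ _
      (hmap.trans (range_weightMap hi hb).symm))
  have e₂ := LinearMap.quotKerEquivRange (R := ℂ) (M := invariantPoly n d (youngSubgroup i))
    (M₂ := Frobenius r (coinvAction n d)) (weightMap d (youngSubgroup i) b)
  rw [ker_weightMap hb] at e₂
  have e₃ : (invariantPoly n d (youngSubgroup i) ⧸
      (relCoinvIdeal n d (youngSubgroup i)).restrictScalars ℂ) ≃ₗ[ℂ]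
      (invariantPoly n d (youngSubgroup i) ⧸ relCoinvIdeal n d (youngSubgroup i)) :=
    Submodule.Quotient.restrictScalarsEquiv ℂ _
  exact ⟨e₁.trans (e₂.symm.trans e₃)⟩

end Coordinates

end

end WeylModules

theorem mainTheorem12 (r n d : ℕ) (hr : 1 ≤ r) :
    IsLocalWeyl.{u} (zeroMultiset r n d) (LocalWeyl (zeroMultiset r n d))
      (weylVector (zeroMultiset r n d)) ∧
    (∃ φ : LocalWeyl (zeroMultiset r n d) ≃ₗ[ℂ] Frobenius r (coinvRep n d),
      ∀ (x : SL r) (w : LocalWeyl (zeroMultiset r n d)),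
        φ ⁅(cur 1 x : Current r (MvPolynomial (Fin d) ℂ)), w⁆ = ⁅x, φ w⁆) ∧
    ∀ i : Fin (r + 1) → ℕ, ∑ j, i j = n →
      Nonempty
        (weightSpace r (MvPolynomial (Fin d) ℂ) (LocalWeyl (zeroMultiset r n d)) (diffWeight i)
          ≃ₗ[ℂ] (invariantPoly n d (youngSubgroup i) ⧸ relCoinvIdeal n d (youngSubgroup i))) :=
  ⟨isLocalWeyl_localWeyl hr n d, exists_linearEquiv_frobenius hr n d,
    fun i hi => nonempty_weightSpace_equiv hr n d i hi⟩
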